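/- Let $\mathbb{K}$ be a field, $\underline X$ a regular scheme over $\mathbb{K}$ (locally noetherian, with regular local rings), and $\underline D\subset \underline X$ a strict normal crossing divisor: near each point $x$ of $\underline X$, $\underline D$ is defined by an equation $z_1\cdots z_j=0$ with $j\ge 0$, where $z_1,\dots,z_j\in\mathcal{O}_{\underline X,x}$ vanish at $x$ and have linearly independent differentials in $\mathfrak m_x/\mathfrak m_x^2$. Let $X$ be the log scheme $(\underline X,\mathscr M)$ whose log structure is the étale sheaf of monoids $\mathscr M\subset\mathcal{O}_{\underline X}$ of functions that are invertible on $\underline X\setminus\underline D$, and let $*$ be $\operatorname{Spec}\mathbb{K}$ with the trivial log structure $\mathcal{O}^\times$. A *virtual morphism* of log schemes $(\underline Y,\mathscr M_Y)\to(\underline X,\mathscr M_X)$ is a morphism of schemes $\underline\phi:\underline Y\to\underline X$ together with a morphism $\phi^*:\underline\phi^{-1}\mathscr M_X^{\mathrm{gp}}\to\mathscr M_Y^{\mathrm{gp}}$ of étale sheaves of abelian groups (where $\mathrm{gp}$ denotes group completion) which is compatible with the pullback $\underline\phi^{-1}\mathcal{O}_{\underline X}^\times\to\mathcal{O}_{\underline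 Y}^\times$ of invertible functions. Let $\underline X_j$ be the locus where exactly $j$ irreducible components of $\underline D$ meet, with its reduced structure. For a $\mathbb{K}$-point $x\in\underline X_j(\mathbb{K})$ let $N_x=T_x\underline X/T_x\underline X_j$. An element of $N_x$ is *inward-pointing* if its image in $T_x\underline X/T_x\underline D_i$ is nonzero for every irreducible component $\underline D_i$ of $\underline D$ through $x$. A *tangential basepoint* of $(\underline X,\underline D)$ is a pair $(x,v)$ of a $\mathbb{K}$-point $x$ of $\underline X$ and an inward-pointing $v\in N_x$. **Theorem.** There is a unique bijection between the set of virtual morphisms $*\to X$ over $\mathbb{K}$ and the set of tangential basepoints of $(\underline X,\underline D)$ such that, if $\phi$ corresponds to $(x,v)$, then the morphism of schemes underlying $\phi$ is $x$, and $$\phi^*(z)=\langle \mathrm{d}z|_x, v\rangle\in\mathbb{K}^\times$$ for every irreducible component $\underline D_i$ of $\underline D$ through $x$ and every section $z$ of $\mathscr M$ over an open neighbourhood of $x$ whose germ at $x$ generates the ideal of $\underline D_i$ in $\mathcal{O}_{\underline X,x}$. In particular the bijection does not depend on a choice of local coordinates: in terms of any local equations $z_1,\dots,z_j\in\mathscr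 M$ of the components of $\underline D$ through $x$, it sends $\phi$ to $\bigl(x,\sum_i\phi^*(z_i)\,\partial_{z_i}|_x\bigr)$. -/

import Mathlib

open CategoryTheory AlgebraicGeometry Limits Opposite

universe u

namespace LogGeometry

noncomputable section

/-! ### Functions on the small étale site -/

/-- Global functions on a scheme are maps to the affine line. -/
def functionsRepresentable : (Scheme.Γ.{u} ⋙ forget CommRingCat.{u}).RepresentableBy
    (Spec (CommRingCat.of (Polynomial (ULift.{u} ℤ)))) where
  homEquiv {Y} := ((ΓSpec.adjunction.homEquiv Y
      (op (CommRingCat.of (Polynomial (ULift.{u} ℤ))))).symm.trans (opEquiv _ _)).trans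
    { toFun := fun φ => φ.hom Polynomial.X
      invFun := fun f => CommRingCat.ofHom (R := Polynomial (ULift.{u} ℤ)) (S := Γ(Y, ⊤))
        (Polynomial.eval₂RingHom ((Int.castRingHom _).comp ULift.ringEquiv.toRingHom) f)
      left_inv := fun φ => by
        ext1
        apply Polynomial.ringHom_ext'
        · apply RingHom.ext
          rintro ⟨n⟩
          have : (ULift.up n : ULift.{u} ℤ) = (n : ULift.{u} ℤ) := rfl
          rw [this]
          simp only [map_intCast]
        · exact Polynomial.eval₂_X _ _
      right_inv := fun f => Polynomial.eval₂_X _ _ }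
  homEquiv_comp {Y Y'} f g := by
    change (((ΓSpec.adjunction.homEquiv _ _).symm (f ≫ g)).unop).hom Polynomial.X = _
    rw [Adjunction.homEquiv_naturality_left_symm]
    rfl

section Over

variable (P : MorphismProperty Scheme.{u})

theorem over_w_apply {X : Scheme.{u}} {U V : P.Over ⊤ X} (f : U ⟶ V) (x : U.left) :
    V.hom (f.left x) = U.hom x :=
  congrArg (fun g => g.base x) (CategoryTheory.Over.w f.toCommaMorphism)

variable [P.IsStableUnderBaseChange]

/-- Base change along `φ : X ⟶ Y` of `Y`-schemes with property `P`. -/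
def overPullback {X Y : Scheme.{u}} (φ : X ⟶ Y) : P.Over ⊤ Y ⥤ P.Over ⊤ X :=
  MorphismProperty.Over.pullback P ⊤ φ

variable [P.IsMultiplicative] [P.HasOfPostcompProperty P]

theorem over_forget_isContinuous (X : Scheme.{u}) :
    (MorphismProperty.Over.forget P ⊤ X).IsContinuous
      (X.smallGrothendieckTopology P) (X.overGrothendieckTopology P) := by
  have : RepresentablyFlat (MorphismProperty.Over.forget P ⊤ X) := flat_of_preservesFiniteLimits _
  have : (MorphismProperty.Over.forget P ⊤ X).LocallyCoverDense (X.overGrothendieckTopology P) :=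
    Scheme.locallyCoverDense_of_le X le_rfl
  rw [Functor.isContinuous_iff_coverPreserving]
  exact (MorphismProperty.Over.forget P ⊤ X).coverPreserving_restrictedTopology _

theorem exists_lift_of_mem_smallTopology {X : Scheme.{u}} {U : P.Over ⊤ X} {R : Sieve U}
    (hR : R ∈ X.smallGrothendieckTopology P U) (x : U.left) :
    ∃ (V : P.Over ⊤ X) (f : V ⟶ U) (y : V.left), f.left y = x ∧ R f := by
  obtain ⟨𝒰, _, _, h⟩ := (Scheme.mem_smallGrothendieckTopology _ _).1 hR
  obtain ⟨y, hy⟩ := 𝒰.covers x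
  exact ⟨_, (𝒰.f (𝒰.idx x)).asOverProp X, y, hy, h _ _ ⟨_⟩⟩

end Over

/-- The structure sheaf `𝒪_X` on the small étale site, `U ↦ Γ(U, 𝒪_U)`, as a presheaf of
multiplicative monoids. -/
def functions (X : Scheme.{u}) : X.Etaleᵒᵖ ⥤ CommMonCat.{u} :=
  (Scheme.Etale.forget X ⋙ Over.forget X).op ⋙ Scheme.Γ.{u} ⋙ forget₂ CommRingCat CommMonCat

theorem isSheaf_functions (X : Scheme.{u}) :
    Presieve.IsSheaf X.smallEtaleTopology (functions X ⋙ forget CommMonCat) := by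
  have h : Presieve.IsSheaf Scheme.etaleTopology (Scheme.Γ.{u} ⋙ forget CommRingCat.{u}) := by
    have : (Scheme.Γ.{u} ⋙ forget CommRingCat.{u}).IsRepresentable :=
      ⟨_, ⟨functionsRepresentable⟩⟩
    have : Scheme.etaleTopology.{u}.Subcanonical := .of_le
      (Scheme.etaleTopology_le_proetaleTopology.trans Scheme.proetaleTopology_le_fpqcTopology)
    exact GrothendieckTopology.Subcanonical.isSheaf_of_isRepresentable _
  have : (Scheme.Etale.forget X).IsContinuous X.smallEtaleTopology
    (Scheme.etaleTopology.over X) := over_forget_isContinuous @Etale X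
  have : (Scheme.Etale.forget X ⋙ Over.forget X).IsContinuous X.smallEtaleTopology
    Scheme.etaleTopology := Functor.isContinuous_comp _ _ _ (Scheme.etaleTopology.over X) _
  exact Functor.op_comp_isSheaf_of_isSheaf_type (Scheme.Etale.forget X ⋙ Over.forget X)
    X.smallEtaleTopology h

/-! ### Log structures -/

/-- A log structure on a scheme `X`: a sheaf of commutative monoids `ℳ` on the small étale site
of `X` with a morphism of sheaves of monoids `α : ℳ ⟶ 𝒪_X` such that the induced morphism
`α⁻¹(𝒪_X^×) ⟶ 𝒪_X^×` is an isomorphism. -/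
structure LogStructure (X : Scheme.{u}) where
  monoid : X.Etaleᵒᵖ ⥤ CommMonCat.{u}
  isSheaf : Presieve.IsSheaf X.smallEtaleTopology (monoid ⋙ forget CommMonCat)
  α : monoid ⟶ functions X
  existsUnique_unit : ∀ (U : X.Etale) (a : Γ(U.left, ⊤)ˣ),
    ∃! m : monoid.obj (op U), α.app (op U) m = (a : Γ(U.left, ⊤))

namespace LogStructure

variable {X : Scheme.{u}} (M : LogStructure X)

/-- The function `α(m)` on `U` underlying a section `m` of `ℳ` over `U`. -/
def fn (U : X.Etale) : M.monoid.obj (op U) →* Γ(U.left, ⊤) :=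
  (M.α.app (op U)).hom

theorem fn_injective_of_isUnit (U : X.Etale) {m m' : M.monoid.obj (op U)}
    (h : M.fn U m = M.fn U m') (hm : IsUnit (M.fn U m)) : m = m' :=
  (M.existsUnique_unit U hm.unit).unique rfl h.symm

/-- The inclusion `𝒪_X^× ≅ α⁻¹(𝒪_X^×) ⊆ ℳ`. -/
def ofUnit (U : X.Etale) : Γ(U.left, ⊤)ˣ →* M.monoid.obj (op U) :=
  have h (a : Γ(U.left, ⊤)ˣ) : M.fn U (M.existsUnique_unit U a).choose = a :=
    (M.existsUnique_unit U a).choose_spec.1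
  { toFun := fun a => (M.existsUnique_unit U a).choose
    map_one' := M.fn_injective_of_isUnit U (by rw [h, map_one, Units.val_one])
      (by rw [h]; exact Units.isUnit _)
    map_mul' := fun a b => M.fn_injective_of_isUnit U
      (by rw [map_mul, h, h, h, Units.val_mul]) (by rw [h]; exact Units.isUnit _) }

end LogStructure

/-- Group completion of commutative monoids. -/
def groupCompletion : CommMonCat.{u} ⥤ CommGrpCat.{u} where
  obj M := CommGrpCat.of (Algebra.GrothendieckGroup M)
  map f := CommGrpCat.ofHom (Algebra.GrothendieckGroup.lift
    (Algebra.GrothendieckGroup.of.comp f.hom))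
  map_id M := by
    ext1
    apply Algebra.GrothendieckGroup.lift.symm.injective
    rw [CommGrpCat.hom_ofHom, Equiv.symm_apply_apply]
    rfl
  map_comp f g := by
    ext1
    apply Algebra.GrothendieckGroup.lift.symm.injective
    rw [CommGrpCat.hom_ofHom, Equiv.symm_apply_apply]
    refine MonoidHom.ext fun m => ?_
    have h {A B : CommMonCat.{u}} (k : A ⟶ B) (a : A) :
        Algebra.GrothendieckGroup.lift (Algebra.GrothendieckGroup.of.comp k.hom)
          (Algebra.GrothendieckGroup.of a) = Algebra.GrothendieckGroup.of (k.hom a) :=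
      DFunLike.congr_fun (Algebra.GrothendieckGroup.lift.symm_apply_apply _) a
    exact ((h g _).symm.trans (congrArg _ (h f m).symm))

instance : HasColimits CommGrpCat.{u} :=
  Adjunction.has_colimits_of_equivalence commGroupAddCommGroupEquivalence.functor

namespace LogStructure

variable {X : Scheme.{u}} (M : LogStructure X)

/-- The group completion `ℳ^gp` of the sheaf of monoids `ℳ`: the sheafification of
`U ↦ ℳ(U)^gp`. -/
def gp : Sheaf X.smallEtaleTopology CommGrpCat.{u} :=
  (presheafToSheaf X.smallEtaleTopology CommGrpCat.{u}).obj (M.monoid ⋙ groupCompletion)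

/-- The natural map `ℳ ⟶ ℳ^gp` on sections over `U`. -/
def toGp (U : X.Etale) : M.monoid.obj (op U) →* M.gp.obj.obj (op U) :=
  ((toSheafify X.smallEtaleTopology (M.monoid ⋙ groupCompletion)).app (op U)).hom.comp
    Algebra.GrothendieckGroup.of

/-- The natural map `𝒪_X^× ⟶ ℳ^gp` on sections over `U`. -/
def unitToGp (U : X.Etale) : Γ(U.left, ⊤)ˣ →* M.gp.obj.obj (op U) :=
  (M.toGp U).comp (M.ofUnit U)

end LogStructure

/-! ### Virtual morphisms -/

/-- Base change of étale schemes along `φ : X ⟶ Y`. -/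
def etalePullback {X Y : Scheme.{u}} (φ : X ⟶ Y) : Y.Etale ⥤ X.Etale :=
  overPullback @Etale φ

/-- The projection `U ×_Y X ⟶ U`. -/
def etalePullbackFst {X Y : Scheme.{u}} (φ : X ⟶ Y) (U : Y.Etale) :
    ((etalePullback φ).obj U).left ⟶ U.left :=
  pullback.fst U.hom φ

/-- Pullback of invertible functions along a morphism of schemes. -/
def pullUnit {X Y : Scheme.{u}} (f : X ⟶ Y) : Γ(Y, ⊤)ˣ →* Γ(X, ⊤)ˣ :=
  Units.map f.appTop.hom

/-- A virtual morphism of log schemes `(X, M) ⟶ (Y, N)`: a morphism of schemes `φ : X ⟶ Y` with a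
morphism of sheaves of groups `φ⁻¹ N^gp ⟶ M^gp`, given through the adjunction between `φ⁻¹` and
`φ_*` as a morphism `N^gp ⟶ φ_* M^gp`, where `(φ_* M^gp)(U) = M^gp(U ×_Y X)`. It is required to be
compatible with the pullback of invertible functions. -/
structure VirtualHom {X Y : Scheme.{u}} (M : LogStructure X) (N : LogStructure Y) where
  base : X ⟶ Y
  pull : N.gp.obj ⟶ (etalePullback base).op ⋙ M.gp.obj
  pull_unit : ∀ (U : Y.Etale) (a : Γ(U.left, ⊤)ˣ),
    pull.app (op U) (N.unitToGp U a) =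
      M.unitToGp ((etalePullback base).obj U) (pullUnit (etalePullbackFst base U) a)

/-- The pullback of a section of `N` over `U` under a virtual morphism: a section of `M^gp` over
`U ×_Y X`. -/
def VirtualHom.pullSection {X Y : Scheme.{u}} {M : LogStructure X} {N : LogStructure Y}
    (φ : VirtualHom M N) (U : Y.Etale) (m : N.monoid.obj (op U)) :
    M.gp.obj.obj (op ((etalePullback φ.base).obj U)) :=
  φ.pull.app (op U) (N.toGp U m)

/-! ### Trivial and divisorial log structures -/

/-- A multiplicative, étale-local condition on functions satisfied by all invertible functions
defines a log structure whose `α` is the inclusion. -/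
def LogStructure.ofSubmonoid {X : Scheme.{u}} (S : ∀ U : X.Etale, Submonoid Γ(U.left, ⊤))
    (res : ∀ {U V : X.Etale} (f : U ⟶ V) (s : Γ(V.left, ⊤)), s ∈ S V → f.left.appTop s ∈ S U)
    (unit : ∀ (U : X.Etale) (s : Γ(U.left, ⊤)), IsUnit s → s ∈ S U)
    (glue : ∀ (U : X.Etale) (s : Γ(U.left, ⊤)), (∀ x : U.left, ∃ (V : X.Etale) (f : V ⟶ U)
      (y : V.left), f.left y = x ∧ f.left.appTop s ∈ S V) → s ∈ S U) :
    LogStructure X where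
  monoid :=
    { obj := fun U => CommMonCat.of (S U.unop)
      map := fun {U V} f => CommMonCat.ofHom
        { toFun := fun s => (⟨f.unop.left.appTop s.1, res f.unop s.1 s.2⟩ : S V.unop)
          map_one' := Subtype.ext (map_one f.unop.left.appTop.hom)
          map_mul' := fun s t => Subtype.ext (map_mul f.unop.left.appTop.hom s.1 t.1) }
      map_id := fun U => CommMonCat.hom_ext <| MonoidHom.ext fun s =>
        Subtype.ext (ConcreteCategory.congr_hom ((functions X).map_id U) s.1)
      map_comp := fun f g => CommMonCat.hom_ext <| MonoidHom.ext fun s =>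
        Subtype.ext (ConcreteCategory.congr_hom ((functions X).map_comp f g) s.1) }
  isSheaf := by
    let G : Subfunctor (functions X ⋙ forget CommMonCat) :=
      { obj := fun U => {s | s ∈ S U.unop}
        map := fun f s hs => res f.unop s hs }
    refine (Subfunctor.isSheaf_iff G (isSheaf_functions X)).2 fun U s hs => ?_
    exact glue U.unop s fun x => exists_lift_of_mem_smallTopology @Etale hs x
  α :=
    { app := fun U => CommMonCat.ofHom (S U.unop).subtype
      naturality := fun _ _ _ => rfl }
  existsUnique_unit U a := ⟨⟨a, unit U a a.isUnit⟩, rfl, fun _ h => Subtype.ext h⟩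

theorem isUnit_restrict_iff {U : Scheme.{u}} (W : U.Opens) (s : Γ(U, ⊤)) :
    IsUnit (U.presheaf.map (homOfLE (le_top : W ≤ ⊤)).op s) ↔ W ≤ U.basicOpen s := by
  constructor
  · intro h
    have := U.basicOpen_of_isUnit h
    rw [Scheme.basicOpen_res] at this
    exact inf_eq_left.1 this
  · intro h
    have h1 : IsUnit (U.presheaf.map (homOfLE (U.basicOpen_le s)).op s) :=
      RingedSpace.isUnit_res_basicOpen U.toRingedSpace s
    have h2 := h1.map (U.presheaf.map (homOfLE h).op).hom
    rw [← CommRingCat.comp_apply, ← Functor.map_comp] at h2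
    exact h2

theorem isUnit_iff_forall {U : Scheme.{u}} (s : Γ(U, ⊤)) :
    IsUnit s ↔ ∀ x : U, x ∈ U.basicOpen s := by
  have := isUnit_restrict_iff (⊤ : U.Opens) s
  rw [show (homOfLE (le_top : (⊤ : U.Opens) ≤ ⊤)).op = 𝟙 _ from rfl, U.presheaf.map_id] at this
  exact this.trans ⟨fun h x => h trivial, fun h x _ => h x⟩

theorem mem_basicOpen_appTop {U V : Scheme.{u}} (f : V ⟶ U) (s : Γ(U, ⊤)) (y : V) :
    y ∈ V.basicOpen (f.appTop s) ↔ f y ∈ U.basicOpen s := by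
  rw [← Scheme.preimage_basicOpen_top]
  rfl

/-- The trivial log structure: `ℳ = 𝒪_X^×`. -/
def trivialLog (X : Scheme.{u}) : LogStructure X :=
  .ofSubmonoid (fun U => IsUnit.submonoid Γ(U.left, ⊤))
    (fun f _ hs => hs.map f.left.appTop.hom)
    (fun _ _ h => h)
    (fun U s h => (isUnit_iff_forall s).2 fun x => by
      obtain ⟨V, f, y, rfl, hy⟩ := h x
      exact (mem_basicOpen_appTop f.left s y).1 ((isUnit_iff_forall _).1 hy y))

/-- The divisorial log structure of a closed subset `D`: the sections of `ℳ` over an étale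
`p : U ⟶ X` are the functions on `U` which are invertible on the complement of `p⁻¹(D)`. -/
def divisorialLog (X : Scheme.{u}) (D : TopologicalSpace.Closeds X) : LogStructure X :=
  .ofSubmonoid
    (fun U => (IsUnit.submonoid _).comap
      (U.left.presheaf.map (homOfLE (le_top : U.hom ⁻¹ᵁ D.compl ≤ ⊤)).op).hom)
    (fun {U V} f s hs => by
      have hs' := (isUnit_restrict_iff (V.hom ⁻¹ᵁ D.compl) s).1 hs
      refine (isUnit_restrict_iff (U.hom ⁻¹ᵁ D.compl) _).2 fun y hy => ?_
      refine (mem_basicOpen_appTop f.left s y).2 (hs' ?_)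
      change V.hom (f.left y) ∈ D.compl
      rw [over_w_apply @Etale f y]
      exact hy)
    (fun _ _ h => h.map (CommRingCat.Hom.hom _))
    (fun U s h => (isUnit_restrict_iff (U.hom ⁻¹ᵁ D.compl) s).2 fun x hx => by
      obtain ⟨V, f, y, rfl, hy⟩ := h x
      refine (mem_basicOpen_appTop f.left s y).1
        ((isUnit_restrict_iff (V.hom ⁻¹ᵁ D.compl) _).1 hy ?_)
      change V.hom y ∈ D.compl
      rw [← over_w_apply @Etale f y]
      exact hx)

/-! ### Regular schemes and strict normal crossing divisors -/

/-- A regular scheme: locally noetherian with regular local rings. -/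
class IsRegularScheme (X : Scheme.{u}) : Prop extends IsLocallyNoetherian X where
  isRegularLocalRing_stalk : ∀ x : X, IsRegularLocalRing (X.presheaf.stalk x)

/-- The maximal ideal `𝔪_x` of the local ring of `X` at `x`. -/
abbrev maxIdeal (X : Scheme.{u}) (x : X) : Ideal (X.presheaf.stalk x) :=
  IsLocalRing.maximalIdeal (X.presheaf.stalk x)

/-- The residue field `κ(x)`. -/
abbrev residueFieldAt (X : Scheme.{u}) (x : X) : Type u :=
  IsLocalRing.ResidueField (X.presheaf.stalk x)

/-- The differential `dz|_x ∈ 𝔪_x / 𝔪_x²` of a function `z` vanishing at `x`. -/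
def differential {X : Scheme.{u}} {x : X} (z : maxIdeal X x) :
    IsLocalRing.CotangentSpace (X.presheaf.stalk x) :=
  (maxIdeal X x).toCotangent z

/-- The ideal of the local ring at `x` generated by an ideal sheaf. -/
def stalkIdeal {X : Scheme.{u}} (D : X.IdealSheafData) (x : X) : Ideal (X.presheaf.stalk x) :=
  ⨆ (U : X.affineOpens) (hx : x ∈ U.1), (D.ideal U).map (X.presheaf.germ U.1 x hx).hom

/-- The closed subscheme with ideal sheaf `D` is a strict normal crossing divisor: near every point
`x` it is defined by an equation `z_1 ⋯ z_j = 0`, where `z_1, …, z_j` are elements of the local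
ring (not of a strict henselization) which vanish at `x` and whose differentials are linearly
independent at `x`. Here `j = 0` exactly when `x ∉ D`. -/
def IsStrictNormalCrossing {X : Scheme.{u}} (D : X.IdealSheafData) : Prop :=
  ∀ x : X, ∃ (j : ℕ) (z : Fin j → maxIdeal X x),
    LinearIndependent (residueFieldAt X x) (fun i => differential (z i)) ∧
    stalkIdeal D x = Ideal.span {∏ i, (z i : X.presheaf.stalk x)}

/-! ### Tangent and normal spaces -/

/-- The Zariski tangent space `T_x X = (𝔪_x / 𝔪_x²)^∨`. -/
abbrev TangentSpaceAt (X : Scheme.{u}) (x : X) : Type u :=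
  Module.Dual (residueFieldAt X x) (IsLocalRing.CotangentSpace (X.presheaf.stalk x))

/-- The ideal in the local ring at `x` of the germs of functions which vanish on `Z` near `x`. -/
def vanishingIdealAt {X : Scheme.{u}} (Z : Set X) (x : X) : Ideal (X.presheaf.stalk x) :=
  Ideal.span {s | ∃ (U : X.Opens) (hx : x ∈ U) (f : Γ(X, U)),
    X.presheaf.germ U x hx f = s ∧ ∀ y ∈ U, y ∈ Z → y ∉ X.basicOpen f}

/-- For a locally closed subset `Z` and `x ∈ Z`, the subspace `T_x Z ⊆ T_x X`, where `Z` has the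
structure of a reduced subscheme. -/
def tangentSubspace {X : Scheme.{u}} (Z : Set X) (x : X) :
    Submodule (residueFieldAt X x) (TangentSpaceAt X x) where
  carrier := {v | ∀ z : maxIdeal X x, (z : X.presheaf.stalk x) ∈ vanishingIdealAt Z x →
    v (differential z) = 0}
  zero_mem' := fun _ _ => rfl
  add_mem' := fun {v w} hv hw z hz => by
    rw [LinearMap.add_apply, hv z hz, hw z hz, add_zero]
  smul_mem' := fun a v hv z hz => by
    rw [LinearMap.smul_apply, hv z hz, smul_zero]

section Components

variable {X : Scheme.{u}} (D : TopologicalSpace.Closeds X)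

/-- The irreducible components of the closed subset `D` passing through `x`. For a strict normal
crossing divisor, these are its local branches at `x`. -/
def branches (x : X) : Set (Set X) :=
  {Z | Maximal (fun Z : Set X => IsIrreducible Z ∧ Z ⊆ D) Z ∧ x ∈ Z}

/-- The stratum `X_j`: the locus where (exactly) `j` irreducible components of `D` meet. -/
def stratum (j : ℕ∞) : Set X :=
  {x | (branches D x).encard = j}

/-- The stratum through the point `x`. -/
def stratumThrough (x : X) : Set X :=
  stratum D (branches D x).encard

/-- The normal space `N_x(X, D) = T_x X / T_x X_j`, where `X_j` is the stratum through `x`. -/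
abbrev NormalSpace (x : X) : Type u :=
  TangentSpaceAt X x ⧸ tangentSubspace (stratumThrough D x) x

/-- The normal space `N_x(X, Z) = T_x X / T_x Z` of a component `Z` of `D` through `x`. -/
abbrev BranchNormalSpace (Z : Set X) (x : X) : Type u :=
  TangentSpaceAt X x ⧸ tangentSubspace Z x

theorem exists_open_branches_subset [IsLocallyNoetherian X] (x : X) :
    ∃ W : X.Opens, x ∈ W ∧ (branches D x).Finite ∧ ∀ y ∈ W, branches D y ⊆ branches D x := by
  obtain ⟨_, ⟨W, hW : IsAffineOpen W, rfl⟩, hxW, -⟩ :=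
    X.isBasis_affineOpens.exists_subset_of_mem_open (Set.mem_univ x) isOpen_univ
  have hN : TopologicalSpace.NoetherianSpace {y // y ∈ W} := by
    have := IsLocallyNoetherian.component_noetherian ⟨W, hW⟩
    exact noetherianSpace_of_isAffineOpen W hW
  obtain ⟨S, hSfin, hScl, hSirr, hS⟩ :=
    TopologicalSpace.NoetherianSpace.exists_finite_set_isClosed_irreducible
      (D.isClosed.preimage (continuous_subtype_val (p := fun y => y ∈ W)))
  -- the components of `D` which meet `W`
  let C : Set (Set X) := {Z | Maximal (fun Z : Set X => IsIrreducible Z ∧ Z ⊆ D) Z ∧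
    (Z ∩ W).Nonempty}
  have hclosed : ∀ Z ∈ C, IsClosed Z := fun Z hZ => by
    have h : closure Z ⊆ Z := hZ.1.le_of_ge
      ⟨hZ.1.prop.1.closure, closure_minimal hZ.1.prop.2 D.isClosed⟩ subset_closure
    exact (subset_closure.antisymm h) ▸ isClosed_closure
  have hC : C.Finite := by
    refine (hSfin.image fun t => closure (Subtype.val '' t)).subset fun Z hZ => ?_
    have hirr : IsIrreducible ((Subtype.val : {y // y ∈ W} → X) ⁻¹' Z) :=
      ⟨let ⟨z, hz, hzW⟩ := hZ.2; ⟨⟨z, hzW⟩, hz⟩,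
        hZ.1.prop.1.2.preimage W.isOpen.isOpenEmbedding_subtypeVal⟩
    have hsub : (Subtype.val : {y // y ∈ W} → X) ⁻¹' Z ⊆ ⋃₀ (hSfin.toFinset : Set (Set {y // y ∈ W})) := by
      rw [hSfin.coe_toFinset, ← hS]
      exact Set.preimage_mono hZ.1.prop.2
    obtain ⟨t, ht, hZt⟩ := isIrreducible_iff_sUnion_isClosed.1 hirr hSfin.toFinset
      (fun t ht => hScl t (hSfin.mem_toFinset.1 ht)) hsub
    rw [hSfin.mem_toFinset] at ht
    refine ⟨t, ht, ?_⟩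
    have hZ' : closure (Subtype.val '' ((Subtype.val : {y // y ∈ W} → X) ⁻¹' Z)) = Z :=
      closure_image_preimage_of_isPreirreducible _ W.isOpen.isOpenMap_subtype_val Z
        hirr.1 hZ.1.prop.1.2 (hclosed Z hZ)
    have hle : Z ⊆ closure (Subtype.val '' t) := by
      conv_lhs => rw [← hZ']
      exact closure_mono (Set.image_mono hZt)
    refine (hZ.1.eq_of_le ⟨?_, ?_⟩ hle).symm
    · exact ((hSirr t ht).image _ continuous_subtype_val.continuousOn).closure
    · refine closure_minimal ?_ D.isClosed
      rintro _ ⟨y, hy, rfl⟩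
      have : y ∈ (Subtype.val : {y // y ∈ W} → X) ⁻¹' D := hS ▸ Set.mem_sUnion_of_mem hy ht
      exact this
  have hbr : branches D x ⊆ C := fun Z hZ => ⟨hZ.1, x, hZ.2, hxW⟩
  have hfin : {Z ∈ C | x ∉ Z}.Finite := hC.subset fun _ h => h.1
  have hcl : IsClosed (⋃₀ {Z ∈ C | x ∉ Z}) :=
    Set.sUnion_eq_biUnion ▸ hfin.isClosed_biUnion fun Z hZ => hclosed Z hZ.1
  refine ⟨W ⊓ ⟨_, hcl.isOpen_compl⟩, ⟨hxW, ?_⟩, hC.subset hbr, fun y hy Z hZ => ⟨hZ.1, ?_⟩⟩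
  · rintro ⟨Z, hZ, hxZ⟩
    exact hZ.2 hxZ
  · by_contra hxZ
    exact hy.2 ⟨Z, ⟨⟨hZ.1, y, hZ.2, hy.1⟩, hxZ⟩, hZ.2⟩

theorem vanishingIdealAt_le [IsLocallyNoetherian X] {x : X} {Z : Set X} (hZ : Z ∈ branches D x) :
    vanishingIdealAt Z x ≤ vanishingIdealAt (stratumThrough D x) x := by
  obtain ⟨W, hxW, hfin, hW⟩ := exists_open_branches_subset D x
  refine Ideal.span_mono ?_
  rintro s ⟨U, hxU, f, rfl, hf⟩
  refine ⟨U ⊓ W, ⟨hxU, hxW⟩, X.presheaf.map (homOfLE inf_le_left).op f,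
    X.presheaf.germ_res_apply _ _ _ _, fun y hy hyS hyf => ?_⟩
  have hle : (branches D x).encard ≤ (branches D y).encard := le_of_eq (Eq.symm hyS)
  have heq : branches D y = branches D x :=
    (hfin.subset (hW y hy.2)).eq_of_subset_of_encard_le (hW y hy.2) hle
  rw [Scheme.basicOpen_res] at hyf
  exact hf y hy.1 (heq ▸ hZ : Z ∈ branches D y).2 hyf.2

/-- The tangent space of the stratum through `x` is contained in the tangent space of every
component of `D` through `x`. -/
theorem tangentSubspace_stratumThrough_le [IsLocallyNoetherian X] {x : X} {Z : Set X}
    (hZ : Z ∈ branches D x) :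
    tangentSubspace (stratumThrough D x) x ≤ tangentSubspace Z x :=
  fun _ hv z hz => hv z (vanishingIdealAt_le D hZ hz)

/-- The natural projection `N_x(X, D) → N_x(X, Z)` for a component `Z` of `D` through `x`. -/
def normalProjection [IsLocallyNoetherian X] {x : X} {Z : Set X} (hZ : Z ∈ branches D x) :
    NormalSpace D x →ₗ[residueFieldAt X x] BranchNormalSpace Z x :=
  Submodule.factor (tangentSubspace_stratumThrough_le D hZ)

/-- A normal vector is inward pointing if its projection to the normal space of every branch of
`D` at `x` is nonzero. -/
def IsInwardPointing [IsLocallyNoetherian X] {x : X} (v : NormalSpace D x) : Prop :=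
  ∀ (Z : Set X) (hZ : Z ∈ branches D x), normalProjection D hZ v ≠ 0

end Components

/-! ### Tangential basepoints and virtual points -/

section Points

variable {K : Type u} [Field K] {X : Scheme.{u}} (π : X ⟶ Spec (.of K))

/-- The point of `X` underlying a morphism `Spec K ⟶ X`. -/
abbrev imagePoint (p : Spec (.of K) ⟶ X) : X :=
  p (IsLocalRing.closedPoint K)

/-- Evaluation of elements of the residue field `κ(x) → K` at a morphism `p : Spec K ⟶ X` with
image `x`. -/
def evalResidue (p : Spec (.of K) ⟶ X) : residueFieldAt X (imagePoint p) →+* K :=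
  have : IsLocalHom (Scheme.stalkClosedPointTo p).hom := Scheme.isLocalHom_stalkClosedPointTo' p
  IsLocalRing.ResidueField.lift (Scheme.stalkClosedPointTo p).hom

/-- A tangential basepoint of `(X, D)`, for a scheme `π : X ⟶ Spec K` over `K`: a `K`-point of `X`
with an inward-pointing normal vector at it. (The residue field of a `K`-point is `K`.) -/
structure TangentialBasepoint [IsLocallyNoetherian X] (D : TopologicalSpace.Closeds X) where
  point : Spec (.of K) ⟶ X
  point_comp : point ≫ π = 𝟙 _
  vec : NormalSpace D (imagePoint point)
  inward : IsInwardPointing D vec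

/-- A virtual morphism over `K` from `* = Spec K` with the trivial log structure to a log scheme
`(X, M)` with structure morphism `π : X ⟶ Spec K`. A virtual morphism to a scheme with trivial log
structure is the same as a morphism of schemes, so lying over `K` is a condition on the underlying
morphism of schemes. -/
structure VirtualPoint (M : LogStructure X) extends VirtualHom (trivialLog (Spec (.of K))) M where
  base_comp : base ≫ π = 𝟙 _

/-- The elements of `Kˣ` as constant invertible functions on a scheme étale over `Spec K`. -/
def constUnit (V : (Spec (.of K)).Etale) : Kˣ →* Γ(V.left, ⊤)ˣ :=
  (pullUnit V.hom).comp (Units.map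
    ((Scheme.ΓSpecIso (.of K)).inv.hom.toMonoidHom : K →* Γ(Spec (.of K), ⊤)))

/-- An open subset as an object of the small étale site. -/
def openEtale (U : X.Opens) : X.Etale :=
  Scheme.Etale.mk U.ι

/-- The function on the open subset `U` underlying a section over `U` of the sheaf of monoids of a
log structure. -/
def openFn (M : LogStructure X) (U : X.Opens) (m : M.monoid.obj (op (openEtale U))) : Γ(X, U) :=
  U.topIso.hom (M.fn (openEtale U) m)

variable {π}

/-- A virtual point `φ` and a tangential basepoint `(x, v)` correspond to each other if `φ` has
underlying `K`-point `x`, and `φ^*(f) = ⟨df|_x, v⟩ ∈ Kˣ` for every function `f` near `x`, invertible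
outside `D`, which is an equation at `x` of some branch `Z` of `D` at `x`. -/
def Corresponds [IsLocallyNoetherian X] {D : TopologicalSpace.Closeds X}
    (φ : VirtualPoint π (divisorialLog X D)) (t : TangentialBasepoint π D) : Prop :=
  φ.base = t.point ∧
  ∀ (U : X.Opens) (hx : imagePoint t.point ∈ U)
    (m : (divisorialLog X D).monoid.obj (op (openEtale U)))
    (z : maxIdeal X (imagePoint t.point)) (Z : Set X),
    X.presheaf.germ U _ hx (openFn _ U m) = z →
    Z ∈ branches D (imagePoint t.point) →
    vanishingIdealAt Z (imagePoint t.point) = Ideal.span {(z : X.presheaf.stalk _)} →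
    ∀ v : TangentSpaceAt X (imagePoint t.point), Submodule.Quotient.mk v = t.vec →
      ∃ c : Kˣ, (c : K) = evalResidue t.point (v (differential z)) ∧
        φ.pullSection (openEtale U) m =
          (trivialLog (Spec (.of K))).unitToGp _ (constUnit _ c)

end Points

end

end LogGeometry

/-!
A virtual morphism `φ` from `Spec K` with the trivial log structure to the divisorial log scheme of
`(X, D)` is a `K`-point `p : Spec K ⟶ X`, with image `x`, and a homomorphism from `ℳ^gp` to the
direct image of `𝒪^×`. Such a homomorphism is a natural family of homomorphisms
`ℳ(U) → Γ(U ×_X Spec K, 𝒪)ˣ`, for `U` étale over `X`, which extends the pullback of invertible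
functions (`exists_pull`, `VirtualHom.pullUnits`): the group completion and its sheafification
disappear, because the target is already a sheaf of groups (`bijective_unitToGp_trivialLog`).

Let `z_1, …, z_j` be equations at `x` of the components of `D` through `x`. They are part of a
regular system of parameters. This is preserved by étale morphisms (`IsRegularSystem.map`), and
quotients of a regular local ring by part of such a system are regular, hence domains
(`isDomain_of_isRegularLocalRing`). Therefore the `z_i` are pairwise non-associated primes in the
local ring of every étale `U` at every point over `x`, and a function on `U` which is invertible
outside of `D` is, near such a point, a product `a · ∏ z_i ^ n_i` with `a` invertible; the `n_i` and
the germ of `a` are unique (`IsLocalEquations.exists_factorization`,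
`IsLocalEquations.factorization_unique`). It follows that `φ` is determined by `p` and the values
`c_i = φ^*(z_i) ∈ Kˣ`, and that all values occur: the formula `a · ∏ z_i ^ n_i ↦ a|_p · ∏ c_i ^ n_i`
is well defined and glues (`IsLocalEquations.virtualHom_ext`, `IsLocalEquations.exists_virtualHom`).

On the other side, the components of `D` through `x` are the closures of the points given by the
primes `(z_i)`, and the tangent space of the stratum through `x` is the common kernel of the
differentials `dz_i`, as `(z_1, …, z_j)` is a prime ideal whose point lies on the same stratum. The
`dz_i` are therefore coordinates on the normal space `N_x`, and a normal vector is inward pointing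
if and only if all of its coordinates are nonzero (`IsLocalEquations.mk_eq_mk_iff`,
`IsLocalEquations.isInwardPointing_mk_iff`). So virtual points over `p` and inward-pointing normal
vectors at `p` are both given by families `(c_i)` in `Kˣ`. Any other equation of the `i`-th
component is `b · z_i` for an invertible germ `b`, and both `φ^*` and `⟨d(-), v⟩` multiply its value
by `b(x)` (`IsLocalEquations.corresponds_iff`), so the bijection is independent of the `z_i`; the
required property leaves no choice for it.
-/

namespace LogGeometry

noncomputable section

/-! ### Regular systems of parameters -/

section RegularSystems

open IsLocalRing

/-- A finite family `w` in a local ring `R` is a regular system of parameters if it generates the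
maximal ideal and has at most `dim R` members. (By Krull's height theorem it then has exactly
`dim R` members.) -/
structure IsRegularSystem {R ι : Type*} [CommRing R] [IsLocalRing R] [Finite ι] (w : ι → R) :
    Prop where
  span_eq : Ideal.span (Set.range w) = maximalIdeal R
  card_le : ((Nat.card ι : ℕ∞) : WithBot ℕ∞) ≤ ringKrullDim R

namespace IsRegularSystem

variable {R ι : Type*} [CommRing R] [IsLocalRing R] [Finite ι] {w : ι → R}

theorem span_image_le (hw : IsRegularSystem w) (s : Set ι) :
    Ideal.span (w '' s) ≤ maximalIdeal R :=
  hw.span_eq ▸ Ideal.span_mono (Set.image_subset_range w s)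

theorem span_image_ne_top (hw : IsRegularSystem w) (s : Set ι) : Ideal.span (w '' s) ≠ ⊤ :=
  fun h => (maximalIdeal.isMaximal R).ne_top (top_le_iff.1 (h ▸ hw.span_image_le s))

theorem isLocalRing_quotient (hw : IsRegularSystem w) (s : Set ι) :
    IsLocalRing (R ⧸ Ideal.span (w '' s)) :=
  have := Ideal.Quotient.nontrivial_iff.2 (hw.span_image_ne_top s)
  .of_surjective' _ Ideal.Quotient.mk_surjective

theorem spanFinrank_le (hw : IsRegularSystem w) : (maximalIdeal R).spanFinrank ≤ Nat.card ι := by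
  rw [← hw.span_eq, ← Set.image_univ, ← Set.ncard_univ]
  exact (Submodule.spanFinrank_span_le_ncard_of_finite (Set.toFinite _)).trans
    (Set.ncard_image_le (Set.toFinite _))

variable [IsNoetherianRing R]

/-- No proper subfamily of a regular system of parameters generates a member outside of it:
otherwise the maximal ideal would have too few generators. -/
theorem notMem_span_image (hw : IsRegularSystem w) {s : Set ι} {i : ι} (hi : i ∉ s) :
    w i ∉ Ideal.span (w '' s) := by
  intro h
  have h1 : Ideal.span (w '' {i}ᶜ) = maximalIdeal R := by
    refine le_antisymm (hw.span_image_le _) ?_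
    rw [← hw.span_eq, Ideal.span_le]
    rintro _ ⟨k, rfl⟩
    by_cases hk : k = i
    · subst hk
      refine Ideal.span_mono (Set.image_mono ?_) h
      intro l hl hlk
      exact hi (hlk ▸ hl)
    · exact Ideal.subset_span ⟨k, hk, rfl⟩
  have h2 := ringKrullDim_le_spanFinrank_maximalIdeal R
  have h3 : (maximalIdeal R).spanFinrank ≤ (w '' {i}ᶜ).ncard := by
    rw [← h1]
    exact Submodule.spanFinrank_span_le_ncard_of_finite (Set.toFinite _)
  have h4 : (w '' {i}ᶜ).ncard ≤ Nat.card ι - 1 := by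
    refine (Set.ncard_image_le (Set.toFinite _)).trans ?_
    rw [Set.ncard_compl, Set.ncard_singleton]
  have h5 := hw.card_le.trans h2
  have h6 : Nat.card ι ≤ (maximalIdeal R).spanFinrank := by exact_mod_cast h5
  have : 0 < Nat.card ι := Nat.card_pos_iff.2 ⟨⟨i⟩, inferInstance⟩
  omega

theorem isRegularLocalRing (hw : IsRegularSystem w) : IsRegularLocalRing R :=
  .of_spanFinrank_maximalIdeal_le _ (le_trans (mod_cast hw.spanFinrank_le) hw.card_le)

/-- Modulo some members of a regular system of parameters, the others form one. -/
theorem quotient (hw : IsRegularSystem w) (s : Set ι) [IsLocalRing (R ⧸ Ideal.span (w '' s))] :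
    IsRegularSystem fun i : ↥sᶜ => Ideal.Quotient.mk (Ideal.span (w '' s)) (w i) where
  span_eq := by
    have h : maximalIdeal (R ⧸ Ideal.span (w '' s)) =
        (maximalIdeal R).map (Ideal.Quotient.mk (Ideal.span (w '' s))) :=
      (map_maximalIdeal_of_surjective _ Ideal.Quotient.mk_surjective).symm
    rw [h, ← hw.span_eq, Ideal.map_span]
    refine le_antisymm (Ideal.span_mono ?_) (Ideal.span_le.2 ?_)
    · rintro _ ⟨i, rfl⟩
      exact ⟨_, ⟨i, rfl⟩, rfl⟩
    · rintro _ ⟨_, ⟨i, rfl⟩, rfl⟩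
      by_cases hi : i ∈ s
      · rw [Ideal.Quotient.eq_zero_iff_mem.2
          (Ideal.subset_span (Set.mem_image_of_mem w hi))]
        exact zero_mem _
      · exact Ideal.subset_span ⟨⟨i, hi⟩, rfl⟩
  card_le := by
    -- the dimension drops by at most the number of equations
    have h1 := ringKrullDim_le_ringKrullDim_quotient_add_encard (w '' s) (by
      rw [IsLocalRing.ringJacobson_eq_maximalIdeal]
      exact (Ideal.span_le.1 (hw.span_image_le s) : w '' s ⊆ maximalIdeal R))
    have h2 := hw.card_le.trans h1
    rw [← (Set.toFinite (w '' s)).cast_ncard_eq] at h2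
    have h3 : (w '' s).ncard ≤ s.ncard := Set.ncard_image_le (Set.toFinite _)
    have h4 := Set.ncard_add_ncard_compl s
    rw [Nat.card_coe_set_eq]
    obtain ⟨d, hd⟩ : ∃ d : ℕ, ((d : ℕ∞) : WithBot ℕ∞) = ringKrullDim (R ⧸ Ideal.span (w '' s)) := by
      obtain ⟨a, ha⟩ := WithBot.ne_bot_iff_exists.1
        (ringKrullDim_ne_bot (R := R ⧸ Ideal.span (w '' s)))
      have ha' : a ≠ ⊤ := fun h =>
        ringKrullDim_ne_top (R := R ⧸ Ideal.span (w '' s)) (by rw [← ha, h]; rfl)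
      obtain ⟨d, rfl⟩ := ENat.ne_top_iff_exists.1 ha'
      exact ⟨d, ha⟩
    rw [← hd] at h2 ⊢
    have h5 : Nat.card ι ≤ d + (w '' s).ncard := by exact_mod_cast h2
    have h6 : sᶜ.ncard ≤ d := by omega
    exact_mod_cast h6

end IsRegularSystem

/-- Elements of the maximal ideal of a regular local ring with linearly independent differentials
are part of a regular system of parameters. -/
theorem exists_isRegularSystem {R : Type u} [CommRing R] [IsRegularLocalRing R] {ι : Type*}
    {z : ι → maximalIdeal R}
    (hz : LinearIndependent (ResidueField R) fun i => (maximalIdeal R).toCotangent (z i)) :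
    ∃ (κ : Type u) (_ : Finite κ) (w : κ → R) (e : ι ↪ κ),
      IsRegularSystem w ∧ ∀ i, w (e i) = z i := by
  -- extend the differentials to a basis `b` of the cotangent space, and lift it to the ring so that
  -- `w` restricts to `z`
  let b := Module.Basis.extend hz.linearIndepOn_id
  have hfin := Module.Finite.finite_basis b
  have hsub := hz.linearIndepOn_id.subset_extend (Set.subset_univ _)
  let e : ι ↪ hz.linearIndepOn_id.extend (Set.subset_univ _) :=
    ⟨fun i => ⟨_, hsub ⟨i, rfl⟩⟩, fun i k h => hz.injective (congrArg Subtype.val h)⟩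
  choose f hf using (maximalIdeal R).toCotangent_surjective
  let w := Function.extend e z fun k => f (b k)
  have hwe (i) : w (e i) = z i := e.injective.extend_apply _ _ i
  have hw : (maximalIdeal R).toCotangent ∘ w = b := by
    funext k
    by_cases hk : ∃ i, e i = k
    · obtain ⟨i, rfl⟩ := hk
      rw [Function.comp_apply, hwe, Module.Basis.extend_apply_self]
      rfl
    · rw [Function.comp_apply, show w k = f (b k) from Function.extend_apply' _ _ _ hk, hf]
  refine ⟨_, hfin, fun k => w k, e, ⟨?_, ?_⟩, fun i => congrArg Subtype.val (hwe i)⟩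
  · -- Nakayama's lemma
    have h := (CotangentSpace.span_image_eq_top_iff (R := R) (s := Set.range w)).1 (by
      rw [← Set.range_comp, hw, b.span_eq])
    have h' := congrArg (Submodule.map (maximalIdeal R).subtype) h
    rw [Submodule.map_span, Submodule.map_top, Submodule.range_subtype, ← Set.range_comp] at h'
    exact h'
  · rw [← (isRegularLocalRing_iff R).1 inferInstance,
      spanFinrank_maximalIdeal_eq_finrank_cotangentSpace, Module.finrank_eq_nat_card_basis b]
    rfl

theorem linearIndependent_toCotangent_of_notMem_sq {R : Type*} [CommRing R] [IsLocalRing R]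
    {z : maximalIdeal R} (hz : (z : R) ∉ maximalIdeal R ^ 2) :
    LinearIndependent (ResidueField R) fun _ : Unit => (maximalIdeal R).toCotangent z :=
  .of_subsingleton () fun h => hz ((maximalIdeal R).toCotangent_eq_zero _ |>.1 h)

/-- A regular local ring is a domain. By prime avoidance, unless it is a field, it has a parameter
`z` outside of all minimal primes; by induction `(z)` is prime, and a minimal prime `q ⊆ (z)`
satisfies `q = z q`, so `q = 0` by Nakayama's lemma. -/
theorem isDomain_of_isRegularLocalRing (R : Type u) [CommRing R] [IsRegularLocalRing R] :
    IsDomain R := by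
  induction hn : (maximalIdeal R).spanFinrank using Nat.strong_induction_on generalizing R with
  | h n ih =>
  subst hn
  by_cases h0 : IsField R
  · exact h0.isDomain
  have hdim : ringKrullDim R ≠ 0 := fun h => h0 <| by
    have h1 := (isRegularLocalRing_iff R).1 inferInstance
    rw [h] at h1
    have h2 : (maximalIdeal R).spanFinrank = 0 := by exact_mod_cast h1
    rw [isField_iff_maximalIdeal_eq]
    exact (Submodule.spanFinrank_eq_zero_iff_eq_bot (IsNoetherian.noetherian _)).1 h2
  have hmin := minimalPrimes.finite_of_isNoetherianRing R
  obtain ⟨z, hz, hz2, hzmin⟩ : ∃ z ∈ maximalIdeal R, z ∉ maximalIdeal R ^ 2 ∧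
      ∀ q ∈ minimalPrimes R, z ∉ q := by
    by_contra! hcon
    have hsub : (maximalIdeal R : Set R) ⊆
        ⋃ q ∈ ((insert (maximalIdeal R ^ 2) hmin.toFinset : Finset (Ideal R)) : Set (Ideal R)),
          (q : Set R) := by
      intro z hz
      by_cases hz2 : z ∈ maximalIdeal R ^ 2
      · exact Set.mem_biUnion (by simp) hz2
      · obtain ⟨q, hq, hzq⟩ := hcon z hz hz2
        exact Set.mem_biUnion (by simp [hq]) hzq
    -- prime avoidance allows one non-prime ideal, here the square of the maximal ideal
    obtain ⟨q, hq, hle⟩ := (Ideal.subset_union_prime (f := id) (maximalIdeal R ^ 2)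
      (maximalIdeal R ^ 2) (fun q hq hq1 _ => by
        rw [Finset.mem_insert, Set.Finite.mem_toFinset] at hq
        exact Ideal.IsMinimalPrime.isPrime (hq.resolve_left hq1))).1 hsub
    rw [Finset.mem_insert, Set.Finite.mem_toFinset] at hq
    rcases hq with rfl | hq
    · apply h0
      rw [isField_iff_maximalIdeal_eq]
      refine Submodule.eq_bot_of_le_smul_of_le_jacobson_bot (maximalIdeal R) _
        (IsNoetherian.noetherian _) ?_ (maximalIdeal_le_jacobson _)
      rw [smul_eq_mul, ← pow_two]
      exact hle
    · have hq' := Ideal.IsMinimalPrime.isPrime hq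
      have heq : q = maximalIdeal R := le_antisymm (le_maximalIdeal hq'.ne_top) hle
      apply hdim
      rw [← maximalIdeal_height_eq_ringKrullDim, ← heq, Ideal.height_eq_zero_iff.2 hq]
      rfl
  obtain ⟨κ, _, w, e, hw, hwe⟩ := exists_isRegularSystem (R := R) (ι := Unit)
    (z := fun _ => ⟨z, hz⟩) (linearIndependent_toCotangent_of_notMem_sq hz2)
  have hwz : w (e ()) = z := hwe ()
  have := hw.isLocalRing_quotient {e ()}
  have hw1 := hw.quotient {e ()}
  have := hw1.isRegularLocalRing
  have hdom : IsDomain (R ⧸ Ideal.span (w '' {e ()})) := ih _ (by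
    have h1 := hw1.spanFinrank_le
    have h2 : Nat.card κ ≤ (maximalIdeal R).spanFinrank := by
      exact_mod_cast hw.card_le.trans (ringKrullDim_le_spanFinrank_maximalIdeal R)
    have h3 := Set.ncard_add_ncard_compl {e ()}
    rw [Set.ncard_singleton] at h3
    rw [Nat.card_coe_set_eq] at h1
    omega) _ rfl
  rw [Set.image_singleton, hwz] at hdom
  have hprime := (Ideal.Quotient.isDomain_iff_prime _).1 hdom
  obtain ⟨q, hq, hqz⟩ := Ideal.exists_minimalPrimes_le (I := ⊥) (J := Ideal.span {z}) bot_le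
  have hq' : q.IsPrime := Ideal.IsMinimalPrime.isPrime hq
  have hbot : q = ⊥ := by
    refine Submodule.eq_bot_of_le_smul_of_le_jacobson_bot (Ideal.span {z}) _
      (IsNoetherian.noetherian _) ?_ ?_
    · intro a ha
      obtain ⟨b, rfl⟩ := Ideal.mem_span_singleton'.1 (hqz ha)
      rw [mul_comm, smul_eq_mul]
      exact Ideal.mul_mem_mul (Ideal.mem_span_singleton_self z)
        ((hq'.mem_or_mem ha).resolve_right (hzmin q hq))
    · exact ((Ideal.span_singleton_le_iff_mem _).2 hz).trans (maximalIdeal_le_jacobson _)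
  rw [hbot] at hq'
  exact IsDomain.of_bot_isPrime R

namespace IsRegularSystem

variable {R : Type u} {ι : Type*} [CommRing R] [IsLocalRing R] [IsNoetherianRing R] [Finite ι]
  {w : ι → R}

theorem isPrime_span_image (hw : IsRegularSystem w) (s : Set ι) :
    (Ideal.span (w '' s)).IsPrime := by
  have := hw.isLocalRing_quotient s
  have := (hw.quotient s).isRegularLocalRing
  exact (Ideal.Quotient.isDomain_iff_prime _).1 (isDomain_of_isRegularLocalRing _)

theorem prime (hw : IsRegularSystem w) (i : ι) : Prime (w i) := by
  have h0 : w i ≠ 0 := fun h => hw.notMem_span_image (Set.notMem_empty i) (h ▸ zero_mem _)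
  have := hw.isPrime_span_image {i}
  rwa [Set.image_singleton, Ideal.span_singleton_prime h0] at this

theorem not_dvd (hw : IsRegularSystem w) {i k : ι} (h : k ≠ i) : ¬ w k ∣ w i := fun hd => by
  refine hw.notMem_span_image (s := {k}) (fun hik => h hik.symm) ?_
  rw [Set.image_singleton]
  exact Ideal.mem_span_singleton.2 hd

/-- Regular systems of parameters are preserved by flat local homomorphisms with trivial closed
fibre: the dimension cannot drop by going down. -/
theorem map {S : Type*} [CommRing S] [IsLocalRing S] [IsNoetherianRing S] [Algebra R S]
    [IsLocalHom (algebraMap R S)] [Module.Flat R S] (hw : IsRegularSystem w)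
    (h : (maximalIdeal R).map (algebraMap R S) = maximalIdeal S) :
    IsRegularSystem fun i => algebraMap R S (w i) where
  span_eq := by
    rw [← h, ← hw.span_eq, Ideal.map_span, ← Set.range_comp]
    rfl
  card_le := by
    refine hw.card_le.trans ?_
    have h1 := Ideal.height_eq_height_add_of_liesOver_of_hasGoingDown (maximalIdeal R)
      (maximalIdeal S)
    rw [← maximalIdeal_height_eq_ringKrullDim, ← maximalIdeal_height_eq_ringKrullDim, h1]
    exact_mod_cast le_self_add

end IsRegularSystem

end RegularSystems

/-! ### Generizations of a point and primes of its local ring -/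

section Generizations

variable {X : Scheme.{u}} {x : X}

theorem fromSpecStalk_specializes (P : PrimeSpectrum (X.presheaf.stalk x)) :
    X.fromSpecStalk x P ⤳ x := by
  have h : X.fromSpecStalk x P ∈ Set.range (X.fromSpecStalk x) := ⟨P, rfl⟩
  rwa [Scheme.range_fromSpecStalk] at h

/-- A function near `x` is invertible at the generization of `x` given by a prime `P` of the local
ring if and only if its germ is not in `P`. -/
theorem fromSpecStalk_mem_basicOpen_iff (P : PrimeSpectrum (X.presheaf.stalk x)) {U : X.Opens}
    (hx : x ∈ U) (f : Γ(X, U)) :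
    X.fromSpecStalk x P ∈ X.basicOpen f ↔ X.presheaf.germ U x hx f ∉ P.asIdeal := by
  change P ∈ (X.fromSpecStalk x) ⁻¹ᵁ X.basicOpen f ↔ _
  rw [Scheme.preimage_basicOpen, Scheme.fromSpecStalk_app hx]
  simp only [CommRingCat.comp_apply, Scheme.basicOpen_res, basicOpen_eq_of_affine]
  exact ⟨fun h => h.2, fun h => ⟨(fromSpecStalk_specializes P).mem_open U.2 hx, h⟩⟩

theorem exists_fromSpecStalk_eq {y : X} (h : y ⤳ x) :
    ∃ P : PrimeSpectrum (X.presheaf.stalk x), X.fromSpecStalk x P = y := by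
  have : y ∈ Set.range (X.fromSpecStalk x) := by rwa [Scheme.range_fromSpecStalk]
  exact this

theorem exists_germ_eq (s : X.presheaf.stalk x) :
    ∃ (U : X.Opens) (hx : x ∈ U) (f : Γ(X, U)), X.presheaf.germ U x hx f = s :=
  X.presheaf.exists_germ_eq s

theorem exists_germ_eq_of_finite {ι : Type*} [Finite ι] (s : ι → X.presheaf.stalk x) :
    ∃ (U : X.Opens) (hx : x ∈ U) (f : ι → Γ(X, U)), ∀ i, X.presheaf.germ U x hx (f i) = s i := by
  cases nonempty_fintype ι
  choose V hV f hf using fun i => exists_germ_eq (s i)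
  have hle (i) : Finset.univ.inf V ≤ V i := Finset.inf_le (Finset.mem_univ i)
  have hx : x ∈ Finset.univ.inf V := by
    rw [← SetLike.mem_coe, TopologicalSpace.Opens.coe_finset_inf, Finset.inf_eq_iInf]
    simpa using hV
  exact ⟨_, hx, fun i => X.presheaf.map (homOfLE (hle i)).op (f i), fun i =>
    (X.presheaf.germ_res_apply _ _ _ _).trans (hf i)⟩

/-- The germs at `x` of the functions which vanish on the closure of a generization of `x` form the
corresponding prime ideal. -/
theorem vanishingIdealAt_closure (P : PrimeSpectrum (X.presheaf.stalk x)) :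
    vanishingIdealAt (closure {X.fromSpecStalk x P}) x = P.asIdeal := by
  refine le_antisymm (Ideal.span_le.2 ?_) fun s hs => ?_
  · rintro s ⟨U, hx, f, rfl, hf⟩
    by_contra h
    refine hf _ ((fromSpecStalk_specializes P).mem_open U.2 hx) (subset_closure rfl) ?_
    exact (fromSpecStalk_mem_basicOpen_iff P hx f).2 h
  · obtain ⟨U, hx, f, rfl⟩ := exists_germ_eq s
    refine Ideal.subset_span ⟨U, hx, f, rfl, fun y _ hy hyf => ?_⟩
    refine (fromSpecStalk_mem_basicOpen_iff P hx f).1 ?_ hs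
    exact (specializes_iff_mem_closure.2 hy).mem_open (X.basicOpen f).2 hyf

theorem fromSpecStalk_mem_support_iff (D : X.IdealSheafData)
    (P : PrimeSpectrum (X.presheaf.stalk x)) :
    X.fromSpecStalk x P ∈ D.support ↔ stalkIdeal D x ≤ P.asIdeal := by
  have hgen {U : X.affineOpens} (hx : x ∈ U.1) : X.fromSpecStalk x P ∈ D.support ↔
      (D.ideal U).map (X.presheaf.germ U.1 x hx).hom ≤ P.asIdeal := by
    rw [Scheme.IdealSheafData.mem_support_iff_of_mem
      ((fromSpecStalk_specializes P).mem_open U.1.2 hx), Scheme.mem_zeroLocus_iff,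
      Ideal.map_le_iff_le_comap]
    exact forall₂_congr fun f _ => by
      rw [fromSpecStalk_mem_basicOpen_iff P hx, not_not]
      rfl
  constructor
  · intro h
    exact iSup₂_le fun U hx => (hgen hx).1 h
  · intro h
    obtain ⟨_, ⟨U, hU, rfl⟩, hxU, -⟩ :=
      X.isBasis_affineOpens.exists_subset_of_mem_open (Set.mem_univ x) isOpen_univ
    refine (hgen (U := ⟨U, hU⟩) hxU).2 (le_trans ?_ h)
    exact le_iSup₂ (f := fun (U : X.affineOpens) (hx : x ∈ U.1) =>
      (D.ideal U).map (X.presheaf.germ U.1 x hx).hom) ⟨U, hU⟩ hxU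

end Generizations

/-! ### Local equations of a strict normal crossing divisor -/

section LocalEquations

variable {X : Scheme.{u}} {D : X.IdealSheafData} {x : X} {j : ℕ} {z : Fin j → maxIdeal X x}

/-- The elements `z_1, …, z_j` are equations at `x` of the branches of `D`: they have linearly
independent differentials, and their product generates the ideal of `D` at `x`. -/
structure IsLocalEquations (D : X.IdealSheafData) (z : Fin j → maxIdeal X x) : Prop where
  linearIndependent : LinearIndependent (residueFieldAt X x) fun i => differential (z i)
  stalkIdeal_eq : stalkIdeal D x = Ideal.span {∏ i, (z i : X.presheaf.stalk x)}

instance [IsRegularScheme X] (x : X) : IsRegularLocalRing (X.presheaf.stalk x) :=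
  IsRegularScheme.isRegularLocalRing_stalk x

namespace IsLocalEquations

theorem mem_support_iff (hz : IsLocalEquations D z) (P : PrimeSpectrum (X.presheaf.stalk x)) :
    X.fromSpecStalk x P ∈ D.support ↔ ∃ i, (z i : X.presheaf.stalk x) ∈ P.asIdeal := by
  rw [fromSpecStalk_mem_support_iff, hz.stalkIdeal_eq, Ideal.span_singleton_le_iff_mem,
    P.2.prod_mem_iff]
  simp

/-- The local equations extend to functions on a neighbourhood which are invertible outside of `D`,
because they divide the generators of the ideal of `D`. -/
theorem exists_sections [IsLocallyNoetherian X] (hz : IsLocalEquations D z) :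
    ∃ (U : X.Opens) (hx : x ∈ U) (ζ : Fin j → Γ(X, U)),
      (∀ i, X.presheaf.germ U x hx (ζ i) = z i) ∧
      ∀ i, ∀ y ∈ U, y ∉ D.support → y ∈ X.basicOpen (ζ i) := by
  obtain ⟨U, hxU, ζ, hζ⟩ := exists_germ_eq_of_finite fun i => (z i : X.presheaf.stalk x)
  obtain ⟨_, ⟨A, hA, rfl⟩, hxA, -⟩ :=
    X.isBasis_affineOpens.exists_subset_of_mem_open (Set.mem_univ x) isOpen_univ
  have hN : IsNoetherianRing Γ(X, A) := IsLocallyNoetherian.component_noetherian ⟨A, hA⟩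
  obtain ⟨S, hS⟩ := IsNoetherian.noetherian (D.ideal ⟨A, hA⟩)
  -- each of the finitely many generators `g` of the ideal of `D` is a multiple of `ζ i` near `x`
  have hev : ∀ᶠ y in nhds x, ∀ g ∈ S, ∀ i, y ∈ X.basicOpen g → y ∈ X.basicOpen (ζ i) := by
    rw [Filter.eventually_all_finset]
    intro g hg
    rw [Filter.eventually_all]
    intro i
    have hmem : X.presheaf.germ A x hxA g ∈ stalkIdeal D x := by
      refine (le_iSup₂ (f := fun (U : X.affineOpens) (hx : x ∈ U.1) =>
        (D.ideal U).map (X.presheaf.germ U.1 x hx).hom) ⟨A, hA⟩ hxA) (Ideal.mem_map_of_mem _ ?_)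
      exact hS ▸ Ideal.subset_span hg
    rw [hz.stalkIdeal_eq, Ideal.mem_span_singleton] at hmem
    obtain ⟨a, ha⟩ := (Finset.dvd_prod_of_mem (fun i => (z i : X.presheaf.stalk x))
      (Finset.mem_univ i)).trans hmem
    obtain ⟨V, hxV, b, rfl⟩ := exists_germ_eq a
    rw [← hζ i, ← X.presheaf.germ_res_apply (homOfLE (inf_le_left : U ⊓ V ≤ U)) x ⟨hxU, hxV⟩,
      ← X.presheaf.germ_res_apply (homOfLE (inf_le_right : U ⊓ V ≤ V)) x ⟨hxU, hxV⟩,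
      ← map_mul] at ha
    obtain ⟨W, hxW, i₁, i₂, he⟩ := X.presheaf.germ_eq x hxA (V := U ⊓ V) ⟨hxU, hxV⟩ _ _ ha
    filter_upwards [W.2.mem_nhds hxW] with y hyW hyg
    have h1 : y ∈ X.basicOpen (X.presheaf.map i₁.op g) := by
      rw [Scheme.basicOpen_res]
      exact ⟨hyW, hyg⟩
    erw [he] at h1
    rw [Scheme.basicOpen_res, Scheme.basicOpen_mul, Scheme.basicOpen_res] at h1
    exact h1.2.1.2
  obtain ⟨W', hW, hWo, hxW⟩ := eventually_nhds_iff.1 hev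
  let W : X.Opens := ⟨W', hWo⟩
  refine ⟨U ⊓ A ⊓ W, ⟨⟨hxU, hxA⟩, hxW⟩,
    fun i => X.presheaf.map (homOfLE (inf_le_left.trans inf_le_left)).op (ζ i), fun i =>
      (X.presheaf.germ_res_apply _ _ _ _).trans (hζ i), fun i y hy hyD => ?_⟩
  rw [Scheme.basicOpen_res]
  refine ⟨hy, ?_⟩
  by_contra hcon
  refine hyD ((Scheme.IdealSheafData.mem_support_iff_of_mem (U := ⟨A, hA⟩) hy.1.2).2 ?_)
  rw [← hS]
  erw [Scheme.zeroLocus_span]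
  rw [Scheme.mem_zeroLocus_iff]
  exact fun g hg hyg => hcon (hW y hy.2 g hg i hyg)

variable [IsRegularScheme X]

theorem exists_isRegularSystem (hz : IsLocalEquations D z) :
    ∃ (κ : Type u) (_ : Finite κ) (w : κ → X.presheaf.stalk x) (e : Fin j ↪ κ),
      IsRegularSystem w ∧ ∀ i, w (e i) = z i :=
  LogGeometry.exists_isRegularSystem hz.linearIndependent

theorem prime (hz : IsLocalEquations D z) (i : Fin j) : Prime (z i : X.presheaf.stalk x) := by
  obtain ⟨κ, _, w, e, hw, he⟩ := hz.exists_isRegularSystem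
  exact he i ▸ hw.prime (e i)

theorem not_dvd (hz : IsLocalEquations D z) {i k : Fin j} (h : k ≠ i) :
    ¬ (z k : X.presheaf.stalk x) ∣ z i := by
  obtain ⟨κ, _, w, e, hw, he⟩ := hz.exists_isRegularSystem
  rw [← he, ← he]
  exact hw.not_dvd (e.injective.ne h)

theorem isPrime_span_range (hz : IsLocalEquations D z) :
    (Ideal.span (Set.range fun i => (z i : X.presheaf.stalk x))).IsPrime := by
  obtain ⟨κ, _, w, e, hw, he⟩ := hz.exists_isRegularSystem
  have h := hw.isPrime_span_image (Set.range e)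
  rw [← Set.range_comp] at h
  simpa only [Function.comp_def, he] using h

/-- The prime ideal of the local ring generated by the equation `z_i`. -/
def primeIdeal (hz : IsLocalEquations D z) (i : Fin j) : PrimeSpectrum (X.presheaf.stalk x) where
  asIdeal := Ideal.span {(z i : X.presheaf.stalk x)}
  isPrime := (Ideal.span_singleton_prime (hz.prime i).ne_zero).2 (hz.prime i)

/-- The branch of `D` at `x` with equation `z_i`: the closure of the generization of `x`
given by the prime ideal `(z_i)`. -/
def branch (hz : IsLocalEquations D z) (i : Fin j) : Set X :=
  closure {X.fromSpecStalk x (hz.primeIdeal i)}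

theorem vanishingIdealAt_branch (hz : IsLocalEquations D z) (i : Fin j) :
    vanishingIdealAt (hz.branch i) x = Ideal.span {(z i : X.presheaf.stalk x)} :=
  vanishingIdealAt_closure _

theorem fromSpecStalk_mem_branch_iff (hz : IsLocalEquations D z) (i : Fin j)
    (P : PrimeSpectrum (X.presheaf.stalk x)) :
    X.fromSpecStalk x P ∈ hz.branch i ↔ (z i : X.presheaf.stalk x) ∈ P.asIdeal := by
  constructor
  · intro h
    by_contra hP
    obtain ⟨U, hx, f, hf⟩ := exists_germ_eq (z i : X.presheaf.stalk x)
    rw [← hf, ← fromSpecStalk_mem_basicOpen_iff P hx f] at hP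
    have h' := (specializes_iff_mem_closure.2 h).mem_open (X.basicOpen f).2 hP
    refine (fromSpecStalk_mem_basicOpen_iff _ hx f).1 h' ?_
    rw [hf]
    exact Ideal.mem_span_singleton_self _
  · intro h
    have hle : hz.primeIdeal i ≤ P := (Ideal.span_singleton_le_iff_mem _).2 h
    exact specializes_iff_mem_closure.1
      (((PrimeSpectrum.le_iff_specializes _ _).1 hle).map (X.fromSpecStalk x).continuous)

/-- An irreducible subset of `D` near `x` is contained in one of the branches: its generic point is
given by a prime of the local ring, which contains one of the `z_i`. -/
theorem exists_subset_branch (hz : IsLocalEquations D z) {Z : Set X} (hZ : IsIrreducible Z)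
    (hZD : Z ⊆ D.support) (hx : x ∈ closure Z) : ∃ i, Z ⊆ hz.branch i := by
  obtain ⟨η, hη⟩ := QuasiSober.sober hZ.closure isClosed_closure
  obtain ⟨P, rfl⟩ := exists_fromSpecStalk_eq (hη.specializes hx)
  obtain ⟨i, hi⟩ := (hz.mem_support_iff P).1 (closure_minimal hZD D.support.isClosed hη.mem)
  refine ⟨i, subset_closure.trans ?_⟩
  rw [← hη.def]
  exact closure_minimal (Set.singleton_subset_iff.2 ((hz.fromSpecStalk_mem_branch_iff i P).2 hi))
    isClosed_closure

theorem isIrreducible_branch (hz : IsLocalEquations D z) (i : Fin j) :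
    IsIrreducible (hz.branch i) :=
  isIrreducible_singleton.closure

theorem branch_subset (hz : IsLocalEquations D z) (i : Fin j) : hz.branch i ⊆ D.support :=
  closure_minimal (Set.singleton_subset_iff.2 ((hz.mem_support_iff _).2
    ⟨i, Ideal.mem_span_singleton_self _⟩)) D.support.isClosed

theorem branch_mem_branches (hz : IsLocalEquations D z) (i : Fin j) :
    hz.branch i ∈ branches D.support x := by
  have hx : x ∈ hz.branch i := specializes_iff_mem_closure.1 (fromSpecStalk_specializes _)
  refine ⟨⟨⟨hz.isIrreducible_branch i, hz.branch_subset i⟩, fun Z hZ hle => ?_⟩, hx⟩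
  obtain ⟨k, hk⟩ := hz.exists_subset_branch hZ.1 hZ.2 (subset_closure (hle hx))
  have h1 := (hz.fromSpecStalk_mem_branch_iff k _).1 (hk (hle (subset_closure rfl)))
  have h2 : i = k := by
    by_contra hne
    exact hz.not_dvd hne (Ideal.mem_span_singleton.1 h1)
  exact h2 ▸ hk

theorem branches_eq (hz : IsLocalEquations D z) :
    branches D.support x = Set.range hz.branch := by
  refine subset_antisymm (fun Z hZ => ?_) (Set.range_subset_iff.2 hz.branch_mem_branches)
  obtain ⟨i, hi⟩ := hz.exists_subset_branch hZ.1.prop.1 hZ.1.prop.2 (subset_closure hZ.2)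
  exact ⟨i, (hZ.1.eq_of_le ⟨hz.isIrreducible_branch i, hz.branch_subset i⟩ hi).symm⟩

end IsLocalEquations

end LocalEquations

/-! ### Tangent spaces of branches and strata -/

section Tangent

variable {X : Scheme.{u}} {D : X.IdealSheafData} {x : X} {j : ℕ} {z : Fin j → maxIdeal X x}

theorem differential_smul (a : X.presheaf.stalk x) (z : maxIdeal X x) :
    differential (a • z) = IsLocalRing.residue _ a • differential z := by
  rw [differential, map_smul]
  exact (algebraMap_smul (residueFieldAt X x) a ((maxIdeal X x).toCotangent z)).symm

theorem differential_sum {ι : Type*} (s : Finset ι) (z : ι → maxIdeal X x) :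
    differential (∑ i ∈ s, z i) = ∑ i ∈ s, differential (z i) :=
  map_sum (maxIdeal X x).toCotangent z s

/-- The differential of a unit multiple of an equation. -/
theorem apply_differential_eq_of_eq_mul (v : TangentSpaceAt X x) {z z' : maxIdeal X x}
    {a : X.presheaf.stalk x} (h : (z : X.presheaf.stalk x) = a * z') :
    v (differential z) = IsLocalRing.residue _ a * v (differential z') := by
  have : z = a • z' := Subtype.ext h
  rw [this, differential_smul, map_smul, smul_eq_mul]

namespace IsLocalEquations

/-- The differentials of the equations are coordinates on the normal space. -/
theorem exists_tangent (hz : IsLocalEquations D z) (a : Fin j → residueFieldAt X x) :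
    ∃ v : TangentSpaceAt X x, ∀ i, v (differential (z i)) = a i := by
  let b := Module.Basis.span hz.linearIndependent
  obtain ⟨v, hv⟩ := (b.constr ℕ a).exists_extend
  refine ⟨v, fun i => ?_⟩
  have h := b.constr_basis ℕ a i
  rw [← hv, LinearMap.comp_apply, Submodule.subtype_apply] at h
  rw [← h]
  exact congrArg v (congrArg Subtype.val (Module.Basis.span_apply hz.linearIndependent i)).symm

variable [IsRegularScheme X]

theorem mem_tangentSubspace_branch_iff (hz : IsLocalEquations D z) (i : Fin j)
    (v : TangentSpaceAt X x) :
    v ∈ tangentSubspace (hz.branch i) x ↔ v (differential (z i)) = 0 := by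
  change (∀ z' : maxIdeal X x, _ → _) ↔ _
  rw [hz.vanishingIdealAt_branch]
  refine ⟨fun h => h _ (Ideal.mem_span_singleton_self _), fun h z' hz' => ?_⟩
  obtain ⟨a, ha⟩ := Ideal.mem_span_singleton'.1 hz'
  rw [apply_differential_eq_of_eq_mul v ha.symm, h, mul_zero]

/-- Functions which vanish on the stratum through `x` are in the ideal generated by the `z_i`, as
this ideal is prime and defines a point of the stratum. -/
theorem vanishingIdealAt_stratumThrough_le (hz : IsLocalEquations D z) :
    vanishingIdealAt (stratumThrough D.support x) x ≤
      Ideal.span (Set.range fun i => (z i : X.presheaf.stalk x)) := by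
  let P : PrimeSpectrum (X.presheaf.stalk x) := ⟨_, hz.isPrime_span_range⟩
  have hP : branches D.support (X.fromSpecStalk x P) = branches D.support x := by
    refine subset_antisymm (fun Z hZ => ⟨hZ.1, ?_⟩) fun Z hZ => ⟨hZ.1, ?_⟩
    · rw [hz.branches_eq] at hZ
      obtain ⟨i, rfl⟩ := hZ
      exact (hz.fromSpecStalk_mem_branch_iff i P).2 (Ideal.subset_span ⟨i, rfl⟩)
    · have hcl : closure Z ⊆ Z := hZ.1.le_of_ge ⟨hZ.1.prop.1.closure,
        closure_minimal hZ.1.prop.2 D.support.isClosed⟩ subset_closure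
      exact hcl ((fromSpecStalk_specializes P).mem_closed isClosed_closure (subset_closure hZ.2))
  refine Ideal.span_le.2 ?_
  rintro s ⟨U, hx, f, rfl, hf⟩
  by_contra h
  refine hf _ ((fromSpecStalk_specializes P).mem_open U.2 hx)
    (congrArg Set.encard hP : _) ?_
  exact (fromSpecStalk_mem_basicOpen_iff P hx f).2 h

theorem mem_tangentSubspace_stratumThrough_iff (hz : IsLocalEquations D z)
    (v : TangentSpaceAt X x) :
    v ∈ tangentSubspace (stratumThrough D.support x) x ↔ ∀ i, v (differential (z i)) = 0 := by
  constructor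
  · intro h i
    exact (hz.mem_tangentSubspace_branch_iff i v).1
      (tangentSubspace_stratumThrough_le D.support (hz.branch_mem_branches i) h)
  · intro h z' hz'
    obtain ⟨a, ha⟩ := Ideal.mem_span_range_iff_exists_fun.1
      (hz.vanishingIdealAt_stratumThrough_le hz')
    have hz'' : z' = ∑ i, a i • z i := by
      refine Subtype.ext (ha.symm.trans ?_)
      rw [Submodule.coe_sum]
      rfl
    rw [hz'', differential_sum, map_sum]
    refine Finset.sum_eq_zero fun i _ => ?_
    rw [differential_smul, map_smul, h i, smul_zero]

theorem isInwardPointing_mk_iff (hz : IsLocalEquations D z) (v : TangentSpaceAt X x) :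
    IsInwardPointing D.support (Submodule.Quotient.mk v : NormalSpace D.support x) ↔
      ∀ i, v (differential (z i)) ≠ 0 := by
  have h (i) : normalProjection D.support (hz.branch_mem_branches i) (Submodule.Quotient.mk v) ≠ 0 ↔
      v (differential (z i)) ≠ 0 := by
    refine not_congr (Iff.trans ?_ (hz.mem_tangentSubspace_branch_iff i v))
    exact Submodule.Quotient.mk_eq_zero _
  constructor
  · exact fun hv i => (h i).1 (hv _ (hz.branch_mem_branches i))
  · intro hv Z hZ
    obtain ⟨i, rfl⟩ : Z ∈ Set.range hz.branch := hz.branches_eq ▸ hZ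
    exact (h i).2 (hv i)

theorem mk_eq_mk_iff (hz : IsLocalEquations D z) (v w : TangentSpaceAt X x) :
    (Submodule.Quotient.mk v : NormalSpace D.support x) = Submodule.Quotient.mk w ↔
      ∀ i, v (differential (z i)) = w (differential (z i)) := by
  rw [Submodule.Quotient.eq, hz.mem_tangentSubspace_stratumThrough_iff]
  exact forall_congr' fun i => by rw [LinearMap.sub_apply, sub_eq_zero]

end IsLocalEquations

end Tangent

/-! ### Factorization into powers of primes -/

section Factorization

variable {A ι : Type*} [CommRing A] [IsDomain A] [Fintype ι] {w : ι → A}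

/-- Divisors of powers of products of primes, in a domain which need not be factorial. -/
theorem exists_eq_mul_prod_pow_of_dvd (hw : ∀ i, Prime (w i)) {a : A} {N : ℕ}
    (h : a ∣ (∏ i, w i) ^ N) : ∃ (b : A) (n : ι → ℕ), IsUnit b ∧ a = b * ∏ i, w i ^ n i := by
  classical
  have key : ∀ (s : Finset ι) (x y e : A), x * y = e * ∏ i ∈ s, w i ^ N →
      ∃ (b : A) (n : ι → ℕ), b ∣ e ∧ x = b * ∏ i ∈ s, w i ^ n i := by
    intro s
    induction s using Finset.induction_on with
    | empty =>
      intro x y e h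
      exact ⟨x, 0, ⟨y, by simpa using h.symm⟩, by simp⟩
    | insert i s hi ih =>
      intro x y e h
      rw [Finset.prod_insert hi, mul_comm (w i ^ N), ← mul_assoc] at h
      obtain ⟨k, l, b, c, -, he, rfl, rfl⟩ := mul_eq_mul_prime_pow (hw i) h
      obtain ⟨d, n, hd, rfl⟩ := ih b c e he.symm
      refine ⟨d, Function.update n i k, hd, ?_⟩
      rw [Finset.prod_insert hi, Function.update_self, mul_assoc, mul_comm _ (w i ^ k)]
      congr 2
      refine Finset.prod_congr rfl fun m hm => ?_
      rw [Function.update_of_ne (ne_of_mem_of_not_mem hm hi)]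
  obtain ⟨y, hy⟩ := h
  obtain ⟨b, n, hb, hx⟩ := key Finset.univ a y 1 (by rw [one_mul, ← hy, Finset.prod_pow])
  exact ⟨b, n, isUnit_of_dvd_one hb, hx⟩

theorem eq_of_mul_prod_pow_eq (hw : ∀ i, Prime (w i)) (hne : ∀ i k, k ≠ i → ¬ w k ∣ w i)
    {a b : A} (ha : IsUnit a) (hb : IsUnit b) {n m : ι → ℕ}
    (h : a * ∏ i, w i ^ n i = b * ∏ i, w i ^ m i) : n = m ∧ a = b := by
  classical
  have key : ∀ {a b : A}, IsUnit a → ∀ {n m : ι → ℕ},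
      a * ∏ i, w i ^ n i = b * ∏ i, w i ^ m i → ∀ i, m i ≤ n i := by
    intro a b ha n m h i
    have hnot : ¬ w i ∣ a * ∏ k ∈ Finset.univ.erase i, w k ^ n k := by
      intro hd
      rcases (hw i).dvd_or_dvd hd with hd | hd
      · exact (hw i).not_isUnit (isUnit_of_dvd_unit hd ha)
      · obtain ⟨k, hk, hd⟩ := (hw i).exists_mem_finset_dvd hd
        exact hne k i (Finset.ne_of_mem_erase hk).symm ((hw i).dvd_of_dvd_pow hd)
    have h1 : w i ^ m i ∣ w i ^ n i * (a * ∏ k ∈ Finset.univ.erase i, w k ^ n k) := by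
      rw [mul_left_comm, Finset.mul_prod_erase _ (fun k => w k ^ n k) (Finset.mem_univ i), h]
      exact (Finset.dvd_prod_of_mem (fun k => w k ^ m k) (Finset.mem_univ i)).mul_left b
    exact (pow_dvd_pow_iff (hw i).ne_zero (hw i).not_isUnit).1
      ((hw i).pow_dvd_of_dvd_mul_right _ hnot h1)
  have hnm : n = m := funext fun i => le_antisymm (key hb h.symm i) (key ha h i)
  refine ⟨hnm, ?_⟩
  subst hnm
  exact mul_right_cancel₀ (Finset.prod_ne_zero_iff.2 fun i _ => pow_ne_zero _ (hw i).ne_zero) h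

end Factorization

/-! ### Local equations on étale schemes -/

section EtaleStalks

variable {U X : Scheme.{u}}

theorem isNoetherianRing_stalk_of_etale [IsLocallyNoetherian X] (f : U ⟶ X) [Etale f] (y : U) :
    IsNoetherianRing (U.presheaf.stalk y) := by
  have : IsLocallyNoetherian U := LocallyOfFiniteType.isLocallyNoetherian f
  infer_instance

/-- Étale morphisms pull back regular systems of parameters to regular systems of parameters. -/
theorem IsRegularSystem.stalkMap [IsLocallyNoetherian X] (f : U ⟶ X) [Etale f] (y : U)
    {κ : Type*} [Finite κ] {w : κ → X.presheaf.stalk (f y)} (hw : IsRegularSystem w) :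
    IsRegularSystem fun k => f.stalkMap y (w k) := by
  have := isNoetherianRing_stalk_of_etale f y
  algebraize [(f.stalkMap y).hom]
  have : Algebra.FormallyUnramified (X.presheaf.stalk (f y)) (U.presheaf.stalk y) := by
    rw [← RingHom.formallyUnramified_algebraMap, RingHom.algebraMap_toAlgebra]
    exact FormallyUnramified.stalkMap f y
  have : Algebra.EssFiniteType (X.presheaf.stalk (f y)) (U.presheaf.stalk y) := by
    rw [← RingHom.essFiniteType_algebraMap, RingHom.algebraMap_toAlgebra]
    exact LocallyOfFiniteType.stalkMap f y
  have : Module.Flat (X.presheaf.stalk (f y)) (U.presheaf.stalk y) := Flat.stalkMap f y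
  have : IsLocalHom (algebraMap (X.presheaf.stalk (f y)) (U.presheaf.stalk y)) :=
    inferInstanceAs (IsLocalHom (f.stalkMap y).hom)
  exact hw.map Algebra.FormallyUnramified.map_maximalIdeal

variable {D : X.IdealSheafData} {x : X} {j : ℕ} {z : Fin j → maxIdeal X x} {V : X.Opens}
  {ζ : Fin j → Γ(X, V)}

theorem germ_appLE (f : U ⟶ X) {W : U.Opens} (hW : W ≤ f ⁻¹ᵁ V) {y : U} (hy : y ∈ W)
    (s : Γ(X, V)) : U.presheaf.germ W y hy (f.appLE V W hW s) =
      f.stalkMap y (X.presheaf.germ V (f y) (hW hy) s) := by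
  refine Eq.trans ?_ (Scheme.Hom.germ_stalkMap_apply f V y (hW hy) s).symm
  exact U.presheaf.germ_res_apply (homOfLE hW) y hy (f.app V s)

theorem isUnit_map_of_le_basicOpen {W W' : U.Opens} (b : Γ(U, W)) (h : W' ≤ U.basicOpen b) :
    IsUnit (U.presheaf.map (homOfLE (h.trans (U.basicOpen_le b))).op b) := by
  have h1 : IsUnit (U.presheaf.map (homOfLE (U.basicOpen_le b)).op b) :=
    RingedSpace.isUnit_res_basicOpen U.toRingedSpace b
  have h2 := h1.map (U.presheaf.map (homOfLE h).op).hom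
  rw [← CommRingCat.comp_apply, ← Functor.map_comp] at h2
  exact h2

/-- The germ of a function which is invertible outside of the preimage of `D` divides a power of
the product of the equations. -/
theorem IsLocalEquations.germ_dvd (hz : IsLocalEquations D z) (hx : x ∈ V)
    (hζ : ∀ i, X.presheaf.germ V x hx (ζ i) = z i) (f : U ⟶ X) {y : U} (hy : f y = x)
    (W : U.Opens) (hW : W ≤ f ⁻¹ᵁ V) (hyW : y ∈ W) {m : Γ(U, ⊤)}
    (hm : ∀ q, f q ∉ D.support → q ∈ U.basicOpen m) :
    ∃ N : ℕ, U.presheaf.germ ⊤ y trivial m ∣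
      (∏ i, U.presheaf.germ W y hyW (f.appLE V W hW (ζ i))) ^ N := by
  subst hy
  -- the product vanishes wherever `m` does: at a prime containing `m`, the point is over `D`
  have hmem : ∏ i, U.presheaf.germ W y hyW (f.appLE V W hW (ζ i)) ∈
      (Ideal.span {U.presheaf.germ ⊤ y trivial m}).radical := by
    rw [Ideal.radical_eq_sInf, Ideal.mem_sInf]
    rintro Q ⟨hQ, hQp⟩
    let P : PrimeSpectrum (U.presheaf.stalk y) := ⟨Q, hQp⟩
    have h1 : U.fromSpecStalk y P ∉ U.basicOpen m := fun h =>
      (fromSpecStalk_mem_basicOpen_iff (U := ⊤) P trivial m).1 h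
        (hQ (Ideal.mem_span_singleton_self _))
    have h2 : f (U.fromSpecStalk y P) = X.fromSpecStalk (f y) (P.comap (f.stalkMap y).hom) :=
      congrArg (fun g => g.base P) (Scheme.SpecMap_stalkMap_fromSpecStalk f (x := y)).symm
    have h3 : f (U.fromSpecStalk y P) ∈ D.support := not_imp_comm.1 (hm _) h1
    rw [h2, hz.mem_support_iff] at h3
    obtain ⟨i, hi⟩ := h3
    refine Ideal.mem_of_dvd _ (Finset.dvd_prod_of_mem _ (Finset.mem_univ i)) ?_
    rw [germ_appLE, hζ]
    exact hi
  obtain ⟨N, hN⟩ := hmem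
  exact ⟨N, Ideal.mem_span_singleton.1 hN⟩

variable [IsRegularScheme X]

/-- Over a scheme étale over `X`, the equations `ζ_i` are part of a regular system of parameters at
every point over `x`. -/
theorem IsLocalEquations.exists_isRegularSystem_etale (hz : IsLocalEquations D z) (hx : x ∈ V)
    (hζ : ∀ i, X.presheaf.germ V x hx (ζ i) = z i) (f : U ⟶ X) [Etale f] {y : U} (hy : f y = x) :
    ∃ (κ : Type u) (_ : Finite κ) (w : κ → U.presheaf.stalk y) (e : Fin j ↪ κ),
      IsRegularSystem w ∧ ∀ (i) (W : U.Opens) (hW : W ≤ f ⁻¹ᵁ V) (hyW : y ∈ W),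
        U.presheaf.germ W y hyW (f.appLE V W hW (ζ i)) = w (e i) := by
  subst hy
  obtain ⟨κ, _, w, e, hw, he⟩ := hz.exists_isRegularSystem
  refine ⟨κ, inferInstance, _, e, hw.stalkMap f y, fun i W hW hyW => ?_⟩
  rw [germ_appLE, he, hζ]

/-- Over a scheme étale over `X`, the equations `ζ_i` are distinct primes at every point over `x`,
even up to units. -/
theorem IsLocalEquations.germ_prime (hz : IsLocalEquations D z) (hx : x ∈ V)
    (hζ : ∀ i, X.presheaf.germ V x hx (ζ i) = z i) (f : U ⟶ X) [Etale f] {y : U} (hy : f y = x)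
    (W : U.Opens) (hW : W ≤ f ⁻¹ᵁ V) (hyW : y ∈ W) :
    IsDomain (U.presheaf.stalk y) ∧
    (∀ i, Prime (U.presheaf.germ W y hyW (f.appLE V W hW (ζ i)))) ∧
    ∀ i k, k ≠ i → ¬ U.presheaf.germ W y hyW (f.appLE V W hW (ζ k)) ∣
      U.presheaf.germ W y hyW (f.appLE V W hW (ζ i)) := by
  obtain ⟨κ, _, w, e, hw, he⟩ := hz.exists_isRegularSystem_etale hx hζ f hy
  have := isNoetherianRing_stalk_of_etale f y
  have := hw.isRegularLocalRing
  simp only [he _ W hW hyW]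
  exact ⟨isDomain_of_isRegularLocalRing _, fun i => hw.prime _,
    fun i k hki => hw.not_dvd (e.injective.ne hki)⟩

/-- A function which is invertible outside of the preimage of `D` is, locally at a point over `x`,
the product of an invertible function with powers of the equations. -/
theorem IsLocalEquations.exists_factorization (hz : IsLocalEquations D z) (hx : x ∈ V)
    (hζ : ∀ i, X.presheaf.germ V x hx (ζ i) = z i) (f : U ⟶ X) [Etale f] {y : U} (hy : f y = x)
    {m : Γ(U, ⊤)} (hm : ∀ q, f q ∉ D.support → q ∈ U.basicOpen m) :
    ∃ (W : U.Opens) (hW : W ≤ f ⁻¹ᵁ V) (_ : y ∈ W) (a : Γ(U, W)) (n : Fin j → ℕ), IsUnit a ∧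
      U.presheaf.map (homOfLE le_top).op m = a * ∏ i, f.appLE V W hW (ζ i) ^ n i := by
  have hyV : y ∈ f ⁻¹ᵁ V := by
    change f y ∈ V
    rwa [hy]
  obtain ⟨_, hp, -⟩ := hz.germ_prime hx hζ f hy _ le_rfl hyV
  obtain ⟨N, hN⟩ := hz.germ_dvd hx hζ f hy _ le_rfl hyV hm
  obtain ⟨b, n, hb, hfac⟩ := exists_eq_mul_prod_pow_of_dvd hp hN
  obtain ⟨W₁, hyW₁, b, rfl⟩ := exists_germ_eq b
  have hyb : y ∈ U.basicOpen b := (U.mem_basicOpen b y hyW₁).2 hb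
  let W₂ := U.basicOpen b ⊓ f ⁻¹ᵁ V
  have hyW₂ : y ∈ W₂ := ⟨hyb, hyV⟩
  let a₂ : Γ(U, W₂) := U.presheaf.map (homOfLE (inf_le_left.trans (U.basicOpen_le b))).op b
  have hgerm : U.presheaf.germ ⊤ y trivial m = U.presheaf.germ W₂ y hyW₂
      (a₂ * ∏ i, f.appLE V W₂ inf_le_right (ζ i) ^ n i) := by
    rw [hfac, map_mul, map_prod]
    congr 1
    · exact (U.presheaf.germ_res_apply _ _ _ _).symm
    · simp only [map_pow, germ_appLE]
  obtain ⟨W, hyW, i₁, i₂, he⟩ := U.presheaf.germ_eq (U := ⊤) y trivial hyW₂ _ _ hgerm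
  refine ⟨W, i₂.le.trans inf_le_right, hyW, U.presheaf.map i₂.op a₂, n, ?_, ?_⟩
  · have h := isUnit_map_of_le_basicOpen b (i₂.le.trans inf_le_left)
    rw [← CommRingCat.comp_apply, ← Functor.map_comp]
    exact h
  · refine he.trans ?_
    rw [map_mul, map_prod]
    simp only [map_pow, ← CommRingCat.comp_apply, Scheme.Hom.appLE_map]

/-- The exponents and the germ of the invertible factor are unique. -/
theorem IsLocalEquations.factorization_unique (hz : IsLocalEquations D z) (hx : x ∈ V)
    (hζ : ∀ i, X.presheaf.germ V x hx (ζ i) = z i) (f : U ⟶ X) [Etale f] {y : U} (hy : f y = x)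
    {W : U.Opens} (hW : W ≤ f ⁻¹ᵁ V) (hyW : y ∈ W) {a b : Γ(U, W)} (ha : IsUnit a) (hb : IsUnit b)
    {n k : Fin j → ℕ} (h : a * ∏ i, f.appLE V W hW (ζ i) ^ n i =
      b * ∏ i, f.appLE V W hW (ζ i) ^ k i) :
    n = k ∧ U.presheaf.germ W y hyW a = U.presheaf.germ W y hyW b := by
  obtain ⟨_, hp, hne⟩ := hz.germ_prime hx hζ f hy W hW hyW
  refine eq_of_mul_prod_pow_eq hp hne (ha.map (U.presheaf.germ W y hyW).hom)
    (hb.map (U.presheaf.germ W y hyW).hom) ?_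
  have h' := congrArg (U.presheaf.germ W y hyW) h
  simpa only [map_mul, map_prod, map_pow] using h'

end EtaleStalks

/-! ### Leading coefficients -/

section LeadingCoefficients

variable {X U P : Scheme.{u}} {V : X.Opens} {j : ℕ} {ζ : Fin j → Γ(X, V)}

/-- On the open subset `W` of the `X`-scheme `f : U ⟶ X`, the function `m` is the product of the
invertible function `a` with the monomial in the `ζ_i` with exponents `n`. -/
def IsFactorization (ζ : Fin j → Γ(X, V)) (f : U ⟶ X) (m : Γ(U, ⊤)) {W : U.Opens}
    (hW : W ≤ f ⁻¹ᵁ V) (a : Γ(U, W)) (n : Fin j → ℕ) : Prop :=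
  IsUnit a ∧ U.presheaf.map (homOfLE le_top).op m = a * ∏ i, f.appLE V W hW (ζ i) ^ n i

/-- The function on `Q` obtained from the pullback of `a · ∏ ζ_i ^ n_i` along `r : P ⟶ U` by
replacing the `ζ_i` by `c_i`. -/
def leadingTerm (r : P ⟶ U) (c : Fin j → Γ(P, ⊤)) {W : U.Opens} {Q : P.Opens}
    (hQ : Q ≤ r ⁻¹ᵁ W) (a : Γ(U, W)) (n : Fin j → ℕ) : Γ(P, Q) :=
  r.appLE W Q hQ a * ∏ i, P.presheaf.map (homOfLE le_top).op (c i) ^ n i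

/-- The function `s` on `P` is obtained from the function `m` on `U` by pulling back local
factorizations `m = a · ∏ ζ_i ^ n_i` along `r : P ⟶ U` and replacing the `ζ_i` by `c_i`. -/
def HasLeadingCoeff (ζ : Fin j → Γ(X, V)) (f : U ⟶ X) (r : P ⟶ U) (c : Fin j → Γ(P, ⊤))
    (m : Γ(U, ⊤)) (s : Γ(P, ⊤)) : Prop :=
  ∀ y : P, ∃ (W : U.Opens) (hW : W ≤ f ⁻¹ᵁ V) (Q : P.Opens) (hQ : Q ≤ r ⁻¹ᵁ W)
    (a : Γ(U, W)) (n : Fin j → ℕ), y ∈ Q ∧ IsFactorization ζ f m hW a n ∧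
      P.presheaf.map (homOfLE le_top).op s = leadingTerm r c hQ a n

theorem IsFactorization.restrict {f : U ⟶ X} {m : Γ(U, ⊤)} {W : U.Opens}
    {hW : W ≤ f ⁻¹ᵁ V} {a : Γ(U, W)} {n : Fin j → ℕ} (h : IsFactorization ζ f m hW a n)
    {W' : U.Opens} (hW' : W' ≤ W) :
    IsFactorization ζ f m (hW'.trans hW) (U.presheaf.map (homOfLE hW').op a) n := by
  refine ⟨h.1.map (U.presheaf.map (homOfLE hW').op).hom, ?_⟩
  have h2 := congrArg (U.presheaf.map (homOfLE hW').op) h.2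
  rw [map_mul, map_prod, ← CommRingCat.comp_apply, ← Functor.map_comp] at h2
  simp only [map_pow, ← CommRingCat.comp_apply, Scheme.Hom.appLE_map] at h2
  exact h2

theorem IsFactorization.mul {f : U ⟶ X} {m m' : Γ(U, ⊤)} {W : U.Opens}
    {hW : W ≤ f ⁻¹ᵁ V} {a a' : Γ(U, W)} {n n' : Fin j → ℕ} (h : IsFactorization ζ f m hW a n)
    (h' : IsFactorization ζ f m' hW a' n') :
    IsFactorization ζ f (m * m') hW (a * a') (n + n') := by
  refine ⟨h.1.mul h'.1, ?_⟩
  rw [map_mul, h.2, h'.2, mul_mul_mul_comm, ← Finset.prod_mul_distrib]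
  simp only [Pi.add_apply, pow_add]

/-- Factorizations are compatible with pullback. -/
theorem IsFactorization.comap {f : U ⟶ X} {m : Γ(U, ⊤)} {W : U.Opens}
    {hW : W ≤ f ⁻¹ᵁ V} {a : Γ(U, W)} {n : Fin j → ℕ} (h : IsFactorization ζ f m hW a n)
    {U' : Scheme.{u}} (g : U' ⟶ U) {f' : U' ⟶ X} (hf' : g ≫ f = f')
    (hW' : g ⁻¹ᵁ W ≤ f' ⁻¹ᵁ V) :
    IsFactorization ζ f' (g.appTop m) hW' (g.appLE W (g ⁻¹ᵁ W) le_rfl a) n := by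
  subst hf'
  refine ⟨h.1.map (g.appLE W (g ⁻¹ᵁ W) le_rfl).hom, ?_⟩
  have h2 := congrArg (g.appLE W (g ⁻¹ᵁ W) le_rfl) h.2
  rw [map_mul, map_prod, ← CommRingCat.comp_apply, Scheme.Hom.map_appLE] at h2
  simp only [map_pow, ← CommRingCat.comp_apply, Scheme.Hom.appLE_comp_appLE] at h2
  exact h2

theorem leadingTerm_restrict (r : P ⟶ U) (c : Fin j → Γ(P, ⊤)) {W W' : U.Opens} {Q Q' : P.Opens}
    (hQ : Q ≤ r ⁻¹ᵁ W) (a : Γ(U, W)) (n : Fin j → ℕ) (hW : W' ≤ W) (hQQ : Q' ≤ Q)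
    (hQ' : Q' ≤ r ⁻¹ᵁ W') :
    P.presheaf.map (homOfLE hQQ).op (leadingTerm r c hQ a n) =
      leadingTerm r c hQ' (U.presheaf.map (homOfLE hW).op a) n := by
  rw [leadingTerm, leadingTerm, map_mul, map_prod]
  simp only [map_pow, ← CommRingCat.comp_apply, Scheme.Hom.appLE_map, Scheme.Hom.map_appLE,
    ← Functor.map_comp]
  rfl

theorem leadingTerm_mul (r : P ⟶ U) (c : Fin j → Γ(P, ⊤)) {W : U.Opens} {Q : P.Opens}
    (hQ : Q ≤ r ⁻¹ᵁ W) (a a' : Γ(U, W)) (n n' : Fin j → ℕ) :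
    leadingTerm r c hQ (a * a') (n + n') = leadingTerm r c hQ a n * leadingTerm r c hQ a' n' := by
  rw [leadingTerm, leadingTerm, leadingTerm, map_mul, mul_mul_mul_comm, ← Finset.prod_mul_distrib]
  simp only [Pi.add_apply, pow_add]

theorem isUnit_leadingTerm (r : P ⟶ U) {c : Fin j → Γ(P, ⊤)} (hc : ∀ i, IsUnit (c i))
    {W : U.Opens} {Q : P.Opens} (hQ : Q ≤ r ⁻¹ᵁ W) {a : Γ(U, W)} (ha : IsUnit a)
    (n : Fin j → ℕ) : IsUnit (leadingTerm r c hQ a n) :=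
  (ha.map (r.appLE W Q hQ).hom).mul <| IsUnit.prod_univ_iff.2 fun i =>
    ((hc i).map (P.presheaf.map (homOfLE le_top).op).hom).pow (n i)

theorem germ_leadingTerm (r : P ⟶ U) (c : Fin j → Γ(P, ⊤)) {W : U.Opens} {Q : P.Opens}
    (hQ : Q ≤ r ⁻¹ᵁ W) (a : Γ(U, W)) (n : Fin j → ℕ) {y : P} (hy : y ∈ Q) :
    P.presheaf.germ Q y hy (leadingTerm r c hQ a n) =
      r.stalkMap y (U.presheaf.germ W (r y) (hQ hy) a) *
        ∏ i, P.presheaf.germ ⊤ y trivial (c i) ^ n i := by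
  rw [leadingTerm, map_mul, map_prod, germ_appLE]
  congr 1
  refine Finset.prod_congr rfl fun i _ => ?_
  rw [map_pow]
  exact congrArg (· ^ n i) (P.presheaf.germ_res_apply _ _ _ _)

namespace HasLeadingCoeff

variable {f : U ⟶ X} {r : P ⟶ U} {c : Fin j → Γ(P, ⊤)}

theorem mul {m m' : Γ(U, ⊤)} {s s' : Γ(P, ⊤)} (h : HasLeadingCoeff ζ f r c m s)
    (h' : HasLeadingCoeff ζ f r c m' s') : HasLeadingCoeff ζ f r c (m * m') (s * s') := by
  intro y
  obtain ⟨W, hW, Q, hQ, a, n, hy, h1, h2⟩ := h y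
  obtain ⟨W', hW', Q', hQ', a', n', hy', h1', h2'⟩ := h' y
  have hQQ : Q ⊓ Q' ≤ r ⁻¹ᵁ (W ⊓ W') := fun q hq => ⟨hQ hq.1, hQ' hq.2⟩
  refine ⟨W ⊓ W', inf_le_left.trans hW, Q ⊓ Q', hQQ, _, _, ⟨hy, hy'⟩,
    (h1.restrict inf_le_left).mul (h1'.restrict inf_le_right), ?_⟩
  rw [leadingTerm_mul, ← leadingTerm_restrict r c hQ a n inf_le_left inf_le_left,
    ← leadingTerm_restrict r c hQ' a' n' inf_le_right inf_le_right, ← h2, ← h2', map_mul,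
    ← CommRingCat.comp_apply, ← CommRingCat.comp_apply, ← Functor.map_comp, ← Functor.map_comp]
  rfl

theorem isUnit {m : Γ(U, ⊤)} {s : Γ(P, ⊤)} (h : HasLeadingCoeff ζ f r c m s)
    (hc : ∀ i, IsUnit (c i)) : IsUnit s := by
  refine (isUnit_iff_forall s).2 fun y => ?_
  obtain ⟨W, hW, Q, hQ, a, n, hy, h1, h2⟩ := h y
  have h3 := isUnit_leadingTerm r hc hQ h1.1 n
  rw [← h2, isUnit_restrict_iff] at h3
  exact h3 hy

/-- Pullback of leading coefficients along a commutative square. -/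
theorem comap {m : Γ(U, ⊤)} {s : Γ(P, ⊤)} (h : HasLeadingCoeff ζ f r c m s)
    {U' P' : Scheme.{u}} (g : U' ⟶ U) (k : P' ⟶ P) {f' : U' ⟶ X} {r' : P' ⟶ U'}
    {c' : Fin j → Γ(P', ⊤)} (hf' : g ≫ f = f') (hr : r' ≫ g = k ≫ r)
    (hc : ∀ i, k.appTop (c i) = c' i) :
    HasLeadingCoeff ζ f' r' c' (g.appTop m) (k.appTop s) := by
  intro y
  obtain ⟨W, hW, Q, hQ, a, n, hy, h1, h2⟩ := h (k y)
  have hW' : g ⁻¹ᵁ W ≤ f' ⁻¹ᵁ V := by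
    subst hf'
    exact fun q hq => hW hq
  have hQ' : k ⁻¹ᵁ Q ≤ r' ⁻¹ᵁ (g ⁻¹ᵁ W) := fun q hq => by
    have h3 : r (k q) ∈ W := hQ hq
    have h4 : g (r' q) = r (k q) := congrArg (fun φ => φ.base q) hr
    change g (r' q) ∈ W
    rwa [h4]
  refine ⟨g ⁻¹ᵁ W, hW', k ⁻¹ᵁ Q, hQ', _, n, hy, h1.comap g hf' hW', ?_⟩
  have h5 := congrArg (k.appLE Q (k ⁻¹ᵁ Q) le_rfl) h2
  rw [leadingTerm, map_mul, map_prod] at h5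
  simp only [map_pow, ← CommRingCat.comp_apply, Scheme.Hom.map_appLE,
    Scheme.Hom.appLE_comp_appLE, ← hr] at h5
  rw [leadingTerm]
  simp only [← CommRingCat.comp_apply, Scheme.Hom.appLE_comp_appLE, ← hc]
  exact h5

/-- The leading coefficient of an invertible function is its pullback. -/
theorem of_isUnit {a : Γ(U, ⊤)} (ha : IsUnit a) (hV : ∀ y, f (r y) ∈ V) :
    HasLeadingCoeff ζ f r c a (r.appTop a) := by
  intro y
  refine ⟨f ⁻¹ᵁ V, le_rfl, r ⁻¹ᵁ (f ⁻¹ᵁ V), le_rfl, U.presheaf.map (homOfLE le_top).op a, 0,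
    hV y, ⟨ha.map (U.presheaf.map _).hom, ?_⟩, ?_⟩
  · simp
  · simp only [leadingTerm, ← CommRingCat.comp_apply, Scheme.Hom.map_appLE]
    simp
    rfl

end HasLeadingCoeff

section Unique

variable [IsRegularScheme X] {D : X.IdealSheafData} {x : X} {z : Fin j → maxIdeal X x}
  {f : U ⟶ X} [Etale f] {r : P ⟶ U}

/-- The germ of a leading term does not depend on the factorization, as factorizations are unique at
the points over `x`. -/
theorem germ_leadingTerm_eq (hz : IsLocalEquations D z) (hx : x ∈ V)
    (hζ : ∀ i, X.presheaf.germ V x hx (ζ i) = z i) (hr : ∀ y, f (r y) = x)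
    (c : Fin j → Γ(P, ⊤)) {m : Γ(U, ⊤)} {W W' : U.Opens} {hW : W ≤ f ⁻¹ᵁ V}
    {hW' : W' ≤ f ⁻¹ᵁ V} {a : Γ(U, W)} {a' : Γ(U, W')} {n n' : Fin j → ℕ}
    (h : IsFactorization ζ f m hW a n) (h' : IsFactorization ζ f m hW' a' n')
    {Q Q' : P.Opens} (hQ : Q ≤ r ⁻¹ᵁ W) (hQ' : Q' ≤ r ⁻¹ᵁ W') {y : P} (hy : y ∈ Q)
    (hy' : y ∈ Q') :
    P.presheaf.germ Q y hy (leadingTerm r c hQ a n) =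
      P.presheaf.germ Q' y hy' (leadingTerm r c hQ' a' n') := by
  have h1 := h.restrict (inf_le_left : W ⊓ W' ≤ W)
  have h2 := h'.restrict (inf_le_right : W ⊓ W' ≤ W')
  obtain ⟨rfl, h3⟩ := hz.factorization_unique hx hζ f (hr y) (inf_le_left.trans hW)
    (⟨hQ hy, hQ' hy'⟩ : r y ∈ W ⊓ W') h1.1 h2.1 (h1.2.symm.trans h2.2)
  rw [germ_leadingTerm, germ_leadingTerm]
  erw [U.presheaf.germ_res_apply, U.presheaf.germ_res_apply] at h3
  rw [h3]

theorem HasLeadingCoeff.unique (hz : IsLocalEquations D z) (hx : x ∈ V)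
    (hζ : ∀ i, X.presheaf.germ V x hx (ζ i) = z i) (hr : ∀ y, f (r y) = x)
    (c : Fin j → Γ(P, ⊤)) {m : Γ(U, ⊤)} {s s' : Γ(P, ⊤)}
    (h : HasLeadingCoeff ζ f r c m s) (h' : HasLeadingCoeff ζ f r c m s') : s = s' := by
  refine TopCat.Presheaf.section_ext P.sheaf _ _ _ fun y hy₀ => ?_
  obtain ⟨W, hW, Q, hQ, a, n, hy, h1, h2⟩ := h y
  obtain ⟨W', hW', Q', hQ', a', n', hy', h1', h2'⟩ := h' y
  have h3 := germ_leadingTerm_eq hz hx hζ hr c h1 h1' hQ hQ' hy hy'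
  rw [← h2, ← h2'] at h3
  erw [P.presheaf.germ_res_apply, P.presheaf.germ_res_apply] at h3
  exact h3

/-- The leading terms of local factorizations glue. -/
theorem exists_hasLeadingCoeff (hz : IsLocalEquations D z) (hx : x ∈ V)
    (hζ : ∀ i, X.presheaf.germ V x hx (ζ i) = z i) (hr : ∀ y, f (r y) = x)
    (c : Fin j → Γ(P, ⊤)) {m : Γ(U, ⊤)} (hm : ∀ q, f q ∉ D.support → q ∈ U.basicOpen m) :
    ∃ s, HasLeadingCoeff ζ f r c m s := by
  choose W hW hyW a n ha hfac using fun y => hz.exists_factorization hx hζ f (hr y) hm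
  obtain ⟨s, hs, -⟩ := P.sheaf.existsUnique_gluing' (fun y => r ⁻¹ᵁ W y) ⊤
    (fun y => homOfLE le_top) (fun y _ => TopologicalSpace.Opens.mem_iSup.2 ⟨y, hyW y⟩)
    (fun y => leadingTerm r c le_rfl (a y) (n y)) (by
      intro y y'
      refine TopCat.Presheaf.section_ext P.sheaf _ _ _ fun q hq => ?_
      have h3 := germ_leadingTerm_eq hz hx hζ hr c ⟨ha y, hfac y⟩ ⟨ha y', hfac y'⟩ le_rfl le_rfl
        hq.1 hq.2
      erw [P.presheaf.germ_res_apply, P.presheaf.germ_res_apply]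
      exact h3)
  exact ⟨s, fun y => ⟨W y, hW y, r ⁻¹ᵁ W y, le_rfl, a y, n y, hyW y, ⟨ha y, hfac y⟩, hs y⟩⟩

end Unique

end LeadingCoefficients

/-! ### Base change of the small étale site -/

section Sheaves

variable {X Y : Scheme.{u}}

theorem mem_smallEtaleTopology_of_exists {U : X.Etale} (R : Sieve U)
    (h : ∀ x : U.left, ∃ (V : X.Etale) (f : V ⟶ U) (y : V.left), f.left y = x ∧ R f) :
    R ∈ X.smallEtaleTopology U := by
  choose V f y hy hR using h
  refine GrothendieckTopology.superset_covering _ ?_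
    ((Scheme.ofArrows_mem_smallEtaleTopology_iff f).2 ?_)
  · rw [Sieve.ofArrows, Sieve.generate_le_iff]
    rintro _ _ ⟨x⟩
    exact hR x
  · exact Set.eq_univ_of_forall fun x => Set.mem_iUnion.2 ⟨x, y x, hy x⟩

instance preservesFiniteLimits_overPullback (P : MorphismProperty Scheme.{u})
    [P.IsStableUnderBaseChange] [P.IsMultiplicative] [P.HasOfPostcompProperty P] (φ : X ⟶ Y) :
    PreservesFiniteLimits (overPullback P φ) :=
  inferInstanceAs (PreservesFiniteLimits (MorphismProperty.Over.pullback P ⊤ φ))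

theorem etalePullback_map_fst (φ : X ⟶ Y) {U V : Y.Etale} (f : U ⟶ V) :
    ((etalePullback φ).map f).left ≫ etalePullbackFst φ V = etalePullbackFst φ U ≫ f.left := by
  exact pullback.lift_fst _ _ _

theorem etalePullbackFst_hom (φ : X ⟶ Y) (U : Y.Etale) :
    etalePullbackFst φ U ≫ U.hom = ((etalePullback φ).obj U).hom ≫ φ :=
  pullback.condition

theorem etalePullback_map_hom (φ : X ⟶ Y) {U V : Y.Etale} (f : U ⟶ V) :
    ((etalePullback φ).map f).left ≫ ((etalePullback φ).obj V).hom =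
      ((etalePullback φ).obj U).hom :=
  pullback.lift_snd _ _ _

theorem isPullback_etalePullback_map (φ : X ⟶ Y) {U V : Y.Etale} (f : U ⟶ V) :
    IsPullback ((etalePullback φ).map f).left (etalePullbackFst φ U) (etalePullbackFst φ V)
      f.left := by
  refine IsPullback.of_right (h₁₂ := ((etalePullback φ).obj V).hom) (h₂₂ := V.hom) (v₁₃ := φ) ?_
    (etalePullback_map_fst φ f) (IsPullback.of_hasPullback V.hom φ).flip
  have h1 := (IsPullback.of_hasPullback U.hom φ).flip
  have h2 : f.left ≫ V.hom = U.hom := CategoryTheory.Over.w f.toCommaMorphism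
  rw [h2, etalePullback_map_hom]
  exact h1

/-- A point of `U ×_Y X` whose image in `U` lifts along `f : V ⟶ U` lifts to `V ×_Y X`. -/
theorem exists_etalePullback_map_eq (φ : X ⟶ Y) {U V : Y.Etale} (f : V ⟶ U)
    (x : ((etalePullback φ).obj U).left) (y : V.left) (h : f.left y = etalePullbackFst φ U x) :
    ∃ t : ((etalePullback φ).obj V).left, ((etalePullback φ).map f).left t = x := by
  obtain ⟨t, ht, -⟩ := Scheme.exists_preimage_of_isPullback
    (isPullback_etalePullback_map φ f) x y h.symm
  exact ⟨t, ht⟩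

instance isContinuous_etalePullback (φ : X ⟶ Y) :
    (etalePullback φ).IsContinuous Y.smallEtaleTopology X.smallEtaleTopology := by
  have : PreservesFiniteLimits (etalePullback φ) :=
    preservesFiniteLimits_overPullback @Etale φ
  have : RepresentablyFlat (etalePullback φ) := flat_of_preservesFiniteLimits _
  rw [Functor.isContinuous_iff_coverPreserving]
  refine ⟨fun {U} R hR => mem_smallEtaleTopology_of_exists _ fun x => ?_⟩
  obtain ⟨V, f, y, hy, hf⟩ := exists_lift_of_mem_smallTopology @Etale hR (etalePullbackFst φ U x)
  obtain ⟨t, ht⟩ := exists_etalePullback_map_eq φ f x y hy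
  exact ⟨_, (etalePullback φ).map f, t, ht, Sieve.image_mem_functorPushforward _ _ hf⟩

theorem isSheaf_etalePullback_gp (φ : X ⟶ Y) (M : LogStructure X) :
    Presheaf.IsSheaf Y.smallEtaleTopology ((etalePullback φ).op ⋙ M.gp.obj) :=
  Functor.op_comp_isSheaf (etalePullback φ) _ X.smallEtaleTopology M.gp

/-! ### Group completions of log structures -/

theorem grothendieckGroup_lift_of {A G : Type*} [CommMonoid A] [CommGroup G] (f : A →* G) (a : A) :
    Algebra.GrothendieckGroup.lift f (Algebra.GrothendieckGroup.of a) = f a :=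
  DFunLike.congr_fun (Algebra.GrothendieckGroup.lift.symm_apply_apply f) a

/-- A commutative monoid in which all elements are invertible is its own group completion. -/
theorem bijective_grothendieckGroup_of {A : Type*} [CommMonoid A] (h : ∀ a : A, IsUnit a) :
    Function.Bijective (Algebra.GrothendieckGroup.of (M := A)) := by
  let e : A →* Aˣ :=
    { toFun := fun a => (h a).unit
      map_one' := Units.ext rfl
      map_mul' := fun _ _ => Units.ext rfl }
  have he (a : A) : (e a : A) = a := rfl
  constructor
  · intro a b hab
    have h1 := congrArg (Algebra.GrothendieckGroup.lift e) hab
    rw [grothendieckGroup_lift_of, grothendieckGroup_lift_of] at h1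
    exact congrArg Units.val h1
  · have h1 : (Algebra.GrothendieckGroup.of (M := A)).comp
        ((Units.coeHom A).comp (Algebra.GrothendieckGroup.lift e)) = MonoidHom.id _ := by
      apply Algebra.GrothendieckGroup.lift.symm.injective
      refine MonoidHom.ext fun a => ?_
      refine congrArg Algebra.GrothendieckGroup.of (?_ : ((Algebra.GrothendieckGroup.lift e
        (Algebra.GrothendieckGroup.of a) : Aˣ) : A) = a)
      rw [grothendieckGroup_lift_of]
      exact he a
    exact fun g => ⟨_, DFunLike.congr_fun h1 g⟩

/-- A morphism out of `ℳ^gp` is determined by its values on sections of `ℳ`. -/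
theorem gp_hom_ext {M : LogStructure Y} {F : Y.Etaleᵒᵖ ⥤ CommGrpCat.{u}}
    (hF : Presheaf.IsSheaf Y.smallEtaleTopology F) {α β : M.gp.obj ⟶ F}
    (h : ∀ (U : Y.Etale) (m : M.monoid.obj (op U)),
      α.app (op U) (M.toGp U m) = β.app (op U) (M.toGp U m)) : α = β := by
  refine sheafify_hom_ext Y.smallEtaleTopology _ _ hF ?_
  ext1
  ext1 U
  ext1
  apply Algebra.GrothendieckGroup.lift.symm.injective
  exact MonoidHom.ext fun m => h U.unop m

/-- A natural family of homomorphisms out of `ℳ` to a sheaf of groups extends to `ℳ^gp`. -/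
theorem exists_gp_hom {M : LogStructure Y} {F : Y.Etaleᵒᵖ ⥤ CommGrpCat.{u}}
    (hF : Presheaf.IsSheaf Y.smallEtaleTopology F)
    (h : ∀ U : Y.Etale, M.monoid.obj (op U) →* F.obj (op U))
    (nat : ∀ {U V : Y.Etale} (f : U ⟶ V) (m : M.monoid.obj (op V)),
      h U (M.monoid.map f.op m) = F.map f.op (h V m)) :
    ∃ α : M.gp.obj ⟶ F, ∀ (U : Y.Etale) (m : M.monoid.obj (op U)),
      α.app (op U) (M.toGp U m) = h U m := by
  let η : M.monoid ⋙ groupCompletion ⟶ F :=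
    { app := fun U => CommGrpCat.ofHom (Algebra.GrothendieckGroup.lift (h U.unop))
      naturality := fun {U V} f => by
        ext1
        apply Algebra.GrothendieckGroup.lift.symm.injective
        refine MonoidHom.ext fun m => ?_
        refine (?_ : Algebra.GrothendieckGroup.lift (h V.unop)
          (Algebra.GrothendieckGroup.lift (Algebra.GrothendieckGroup.of.comp (M.monoid.map f).hom)
            (Algebra.GrothendieckGroup.of m)) = F.map f
              (Algebra.GrothendieckGroup.lift (h U.unop) (Algebra.GrothendieckGroup.of m)))
        rw [grothendieckGroup_lift_of, grothendieckGroup_lift_of, MonoidHom.comp_apply,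
          grothendieckGroup_lift_of]
        exact nat f.unop m }
  refine ⟨sheafifyLift Y.smallEtaleTopology η hF, fun U m => ?_⟩
  have h1 := congrArg (fun τ => (τ.app (op U)).hom (Algebra.GrothendieckGroup.of m))
    (toSheafify_sheafifyLift Y.smallEtaleTopology η hF)
  exact h1.trans (grothendieckGroup_lift_of (h U) m)

theorem LogStructure.fn_ofUnit (M : LogStructure X) (U : X.Etale) (a : Γ(U.left, ⊤)ˣ) :
    M.fn U (M.ofUnit U a) = a :=
  (M.existsUnique_unit U a).choose_spec.1

theorem LogStructure.ofUnit_eq (M : LogStructure X) (U : X.Etale) (a : Γ(U.left, ⊤)ˣ)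
    {m : M.monoid.obj (op U)} (h : M.fn U m = a) : M.ofUnit U a = m :=
  M.fn_injective_of_isUnit U ((M.fn_ofUnit U a).trans h.symm)
    (by rw [M.fn_ofUnit]; exact a.isUnit)

theorem bijective_ofUnit_trivialLog (U : X.Etale) :
    Function.Bijective ((trivialLog X).ofUnit U) := by
  constructor
  · intro a b h
    have h1 := congrArg ((trivialLog X).fn U) h
    rw [LogStructure.fn_ofUnit, LogStructure.fn_ofUnit] at h1
    exact Units.ext h1
  · intro m
    have hm : IsUnit ((trivialLog X).fn U m) := m.2
    exact ⟨hm.unit, (trivialLog X).ofUnit_eq U _ rfl⟩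

theorem isUnit_of_trivialLog (U : X.Etale) (m : (trivialLog X).monoid.obj (op U)) : IsUnit m := by
  obtain ⟨a, rfl⟩ := (bijective_ofUnit_trivialLog U).2 m
  exact (Group.isUnit a).map ((trivialLog X).ofUnit U)

/-- A presheaf of groups is a sheaf if its underlying presheaf of sets is one. (The site is too
large for the general statement about functors which reflect limits.) -/
theorem isSheaf_of_isSheaf_forget {C : Type*} [Category* C] {J : GrothendieckTopology C}
    {F : Cᵒᵖ ⥤ CommGrpCat.{u}} (hF : Presieve.IsSheaf J (F ⋙ forget CommGrpCat)) :
    Presheaf.IsSheaf J F := by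
  intro E U S hS x hx
  have hS' := hF S hS
  let y (e : E) : Presieve.FamilyOfElements (F ⋙ forget CommGrpCat) S.arrows :=
    fun V f hf => (x f hf).hom e
  have hy (e : E) : (y e).Compatible := fun V₁ V₂ W g₁ g₂ f₁ f₂ h₁ h₂ h =>
    congrArg (fun φ : E ⟶ F.obj (op W) => φ.hom e) (hx g₁ g₂ h₁ h₂ h)
  choose t ht using fun e => (hS' (y e) (hy e)).exists
  have huniq (a b : F.obj (op U)) (h : ∀ V (f : V ⟶ U), S.arrows f → F.map f.op a = F.map f.op b) :
      a = b := hS'.isSeparatedFor.ext h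
  have hmap {V : C} (f : V ⟶ U) (hf : S.arrows f) (e : E) : F.map f.op (t e) = (x f hf).hom e :=
    ht e f hf
  let T : E ⟶ F.obj (op U) := CommGrpCat.ofHom
    { toFun := t
      map_one' := huniq _ _ fun V f hf => by
        rw [hmap f hf, map_one, map_one]
      map_mul' := fun a b => huniq _ _ fun V f hf => by
        rw [map_mul, hmap f hf, hmap f hf, hmap f hf, map_mul] }
  refine ⟨T, fun V f hf => ?_, fun T' hT' => ?_⟩
  · exact CommGrpCat.hom_ext (MonoidHom.ext fun e => hmap f hf e)
  · refine CommGrpCat.hom_ext (MonoidHom.ext fun e => ?_)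
    refine huniq _ _ fun V f hf => ?_
    exact (congrArg (fun φ : E ⟶ F.obj (op V) => φ.hom e) (hT' f hf)).trans (hmap f hf e).symm

/-- The trivial log structure is already a sheaf of groups. -/
theorem isSheaf_trivialLog_groupCompletion (X : Scheme.{u}) :
    Presheaf.IsSheaf X.smallEtaleTopology ((trivialLog X).monoid ⋙ groupCompletion) := by
  refine isSheaf_of_isSheaf_forget ?_
  refine Presieve.isSheaf_iso _ (NatIso.ofComponents (fun U =>
    (Equiv.ofBijective _ (bijective_grothendieckGroup_of (isUnit_of_trivialLog U.unop))).toIso)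
    fun {U V} f => ?_) (trivialLog X).isSheaf
  ext m
  exact (grothendieckGroup_lift_of
    (Algebra.GrothendieckGroup.of.comp ((trivialLog X).monoid.map f).hom) m).symm

/-- For the trivial log structure, `ℳ^gp = 𝒪^×`. -/
theorem bijective_unitToGp_trivialLog (U : X.Etale) :
    Function.Bijective ((trivialLog X).unitToGp U) := by
  have h1 := isIso_toSheafify X.smallEtaleTopology (isSheaf_trivialLog_groupCompletion X)
  have h2 : Function.Bijective ((toSheafify X.smallEtaleTopology
      ((trivialLog X).monoid ⋙ groupCompletion)).app (op U)).hom :=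
    ConcreteCategory.bijective_of_isIso ((toSheafify X.smallEtaleTopology
      ((trivialLog X).monoid ⋙ groupCompletion)).app (op U))
  exact (h2.comp (bijective_grothendieckGroup_of (isUnit_of_trivialLog U))).comp
    (bijective_ofUnit_trivialLog U)

theorem toGp_naturality (M : LogStructure X) {U V : X.Etale} (f : U ⟶ V)
    (m : M.monoid.obj (op V)) :
    M.gp.obj.map f.op (M.toGp V m) = M.toGp U (M.monoid.map f.op m) := by
  have h1 := congrArg (fun τ => τ.hom (Algebra.GrothendieckGroup.of m))
    ((toSheafify X.smallEtaleTopology (M.monoid ⋙ groupCompletion)).naturality f.op)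
  refine h1.symm.trans (congrArg ((toSheafify X.smallEtaleTopology
    (M.monoid ⋙ groupCompletion)).app (op U)).hom ?_)
  exact grothendieckGroup_lift_of (Algebra.GrothendieckGroup.of.comp (M.monoid.map f.op).hom) m

theorem fn_naturality (M : LogStructure X) {U V : X.Etale} (f : U ⟶ V)
    (m : M.monoid.obj (op V)) : M.fn U (M.monoid.map f.op m) = f.left.appTop (M.fn V m) :=
  congrArg (fun τ => τ.hom m) (M.α.naturality f.op)

theorem unitToGp_naturality (M : LogStructure X) {U V : X.Etale} (f : U ⟶ V) (a : Γ(V.left, ⊤)ˣ) :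
    M.gp.obj.map f.op (M.unitToGp V a) = M.unitToGp U (pullUnit f.left a) := by
  refine (toGp_naturality M f _).trans (congrArg (M.toGp U) ?_)
  refine (M.ofUnit_eq U _ ?_).symm
  rw [fn_naturality, M.fn_ofUnit]
  rfl

end Sheaves

/-! ### Virtual morphisms from a scheme with trivial log structure -/

section VirtualHoms

variable {X Y : Scheme.{u}} {N : LogStructure Y}

theorem pullUnit_comp {X Y Z : Scheme.{u}} (f : X ⟶ Y) (g : Y ⟶ Z) (a : Γ(Z, ⊤)ˣ) :
    pullUnit (f ≫ g) a = pullUnit f (pullUnit g a) :=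
  Units.ext rfl

/-- The pullback of sections of `ℳ` to invertible functions under a virtual morphism from a scheme
with trivial log structure. -/
def VirtualHom.pullUnits (φ : VirtualHom (trivialLog X) N) (U : Y.Etale) :
    N.monoid.obj (op U) →* Γ(((etalePullback φ.base).obj U).left, ⊤)ˣ :=
  ((MulEquiv.ofBijective _ (bijective_unitToGp_trivialLog
    ((etalePullback φ.base).obj U))).symm.toMonoidHom.comp (φ.pull.app (op U)).hom).comp (N.toGp U)

theorem VirtualHom.unitToGp_pullUnits (φ : VirtualHom (trivialLog X) N) (U : Y.Etale)
    (m : N.monoid.obj (op U)) :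
    (trivialLog X).unitToGp _ (φ.pullUnits U m) = φ.pullSection U m :=
  (MulEquiv.ofBijective _ (bijective_unitToGp_trivialLog
    ((etalePullback φ.base).obj U))).apply_symm_apply _

theorem VirtualHom.pullUnits_eq_iff (φ : VirtualHom (trivialLog X) N) (U : Y.Etale)
    (m : N.monoid.obj (op U)) (s : Γ(((etalePullback φ.base).obj U).left, ⊤)ˣ) :
    φ.pullUnits U m = s ↔ φ.pullSection U m = (trivialLog X).unitToGp _ s := by
  rw [← φ.unitToGp_pullUnits]
  exact (bijective_unitToGp_trivialLog _).1.eq_iff.symm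

theorem VirtualHom.pullUnits_naturality (φ : VirtualHom (trivialLog X) N) {U V : Y.Etale}
    (f : U ⟶ V) (m : N.monoid.obj (op V)) :
    φ.pullUnits U (N.monoid.map f.op m) =
      pullUnit ((etalePullback φ.base).map f).left (φ.pullUnits V m) := by
  rw [pullUnits_eq_iff, ← unitToGp_naturality, unitToGp_pullUnits, pullSection, ← toGp_naturality]
  exact congrArg (fun τ => τ.hom (N.toGp V m)) (φ.pull.naturality f.op)

theorem VirtualHom.pullUnits_ofUnit (φ : VirtualHom (trivialLog X) N) (U : Y.Etale)
    (a : Γ(U.left, ⊤)ˣ) :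
    φ.pullUnits U (N.ofUnit U a) = pullUnit (etalePullbackFst φ.base U) a :=
  (φ.pullUnits_eq_iff _ _ _).2 (φ.pull_unit U a)

theorem VirtualHom.ext_of_pullSection {p : X ⟶ Y} {α β : N.gp.obj ⟶
    (etalePullback p).op ⋙ (trivialLog X).gp.obj} (hα hβ)
    (h : ∀ (U : Y.Etale) (m : N.monoid.obj (op U)),
      α.app (op U) (N.toGp U m) = β.app (op U) (N.toGp U m)) :
    (⟨p, α, hα⟩ : VirtualHom (trivialLog X) N) = ⟨p, β, hβ⟩ := by
  obtain rfl := gp_hom_ext (isSheaf_etalePullback_gp p _) h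
  rfl

/-- A virtual morphism from a scheme with trivial log structure is the same as a natural family of
homomorphisms from sections of `ℳ` to invertible functions, extending the pullback of invertible
functions. -/
theorem exists_pull {p : X ⟶ Y}
    (h : ∀ U : Y.Etale, N.monoid.obj (op U) →* Γ(((etalePullback p).obj U).left, ⊤)ˣ)
    (nat : ∀ {U V : Y.Etale} (f : U ⟶ V) (m : N.monoid.obj (op V)),
      h U (N.monoid.map f.op m) = pullUnit ((etalePullback p).map f).left (h V m))
    (unit : ∀ (U : Y.Etale) (a : Γ(U.left, ⊤)ˣ),
      h U (N.ofUnit U a) = pullUnit (etalePullbackFst p U) a) :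
    ∃ (α : N.gp.obj ⟶ (etalePullback p).op ⋙ (trivialLog X).gp.obj) (hα : _),
      ∀ U m, (⟨p, α, hα⟩ : VirtualHom (trivialLog X) N).pullUnits U m = h U m := by
  obtain ⟨α, hα⟩ := exists_gp_hom (M := N) (isSheaf_etalePullback_gp p (trivialLog X))
    (fun U => ((trivialLog X).unitToGp ((etalePullback p).obj U)).comp (h U)) (fun f m => by
      refine (congrArg ((trivialLog X).unitToGp _) (nat f m)).trans ?_
      exact (unitToGp_naturality _ _ _).symm)
  refine ⟨α, fun U a => ?_, fun U m => ?_⟩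
  · exact (hα U _).trans (congrArg ((trivialLog X).unitToGp _) (unit U a))
  · exact (VirtualHom.pullUnits_eq_iff _ _ _ _).2 (hα U m)

/-- Invertible functions on `U ×_Y X` which agree étale-locally on `U` are equal. -/
theorem unit_ext_of_cover (p : X ⟶ Y) {U : Y.Etale} {s t : Γ(((etalePullback p).obj U).left, ⊤)ˣ}
    (h : ∀ x : ((etalePullback p).obj U).left, ∃ (W : Y.Etale) (g : W ⟶ U) (y : W.left),
      g.left y = etalePullbackFst p U x ∧ pullUnit ((etalePullback p).map g).left s =
        pullUnit ((etalePullback p).map g).left t) : s = t := by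
  -- the sieve of the étale schemes over which `s` and `t` agree is covering
  let R : Sieve ((etalePullback p).obj U) :=
    { arrows := fun V f => f.left.appTop s.1 = f.left.appTop t.1
      downward_closed := fun {V V'} f hf g => by
        have h1 (s : Γ(((etalePullback p).obj U).left, ⊤)) :
            (g ≫ f).left.appTop s = g.left.appTop (f.left.appTop s) :=
          ConcreteCategory.congr_hom ((functions X).map_comp f.op g.op) s
        change (g ≫ f).left.appTop _ = (g ≫ f).left.appTop _
        rw [h1, h1]
        exact congrArg _ hf }
  have hR : R ∈ X.smallEtaleTopology _ := mem_smallEtaleTopology_of_exists R fun x => by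
    obtain ⟨W, g, y, hy, hg⟩ := h x
    obtain ⟨w, hw⟩ := exists_etalePullback_map_eq p g x y hy
    exact ⟨_, (etalePullback p).map g, w, hw, congrArg Units.val hg⟩
  exact Units.ext ((isSheaf_functions X R hR).isSeparatedFor.ext fun V f hf => hf)

end VirtualHoms

/-! ### Evaluation at a rational point -/

section Evaluation

variable {K : Type u} [Field K] {X : Scheme.{u}}

/-- All points of the base change of `U` along a `K`-point map to points of `U` over its image. -/
theorem etalePullbackFst_apply (p : Spec (.of K) ⟶ X) (U : X.Etale)
    (y : ((etalePullback p).obj U).left) :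
    U.hom (etalePullbackFst p U y) = imagePoint p :=
  (congrArg (fun g => g.base y) (etalePullbackFst_hom p U)).trans
    (congrArg p (Subsingleton.elim (α := PrimeSpectrum K) _ _))

theorem constUnit_naturality {A B : (Spec (.of K)).Etale} (f : A ⟶ B) (a : Kˣ) :
    pullUnit f.left (constUnit B a) = constUnit A a := by
  have h : f.left ≫ B.hom = A.hom := CategoryTheory.Over.w f.toCommaMorphism
  rw [constUnit, constUnit, MonoidHom.comp_apply, MonoidHom.comp_apply, ← pullUnit_comp, h]

theorem bijective_pullUnit {X Y : Scheme.{u}} (f : X ⟶ Y) [IsIso f] :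
    Function.Bijective (pullUnit f) := by
  refine Function.bijective_iff_has_inverse.2 ⟨pullUnit (inv f), fun a => ?_, fun a => ?_⟩
  · rw [← pullUnit_comp, IsIso.inv_hom_id]
    exact Units.ext (by simp [pullUnit])
  · rw [← pullUnit_comp, IsIso.hom_inv_id]
    exact Units.ext (by simp [pullUnit])

theorem ι_appLE_self (W : X.Opens) (h : ⊤ ≤ W.ι ⁻¹ᵁ W) : W.ι.appLE W ⊤ h = W.topIso.inv := by
  simp
  rfl

theorem stalkClosedPointTo_germ (p : Spec (.of K) ⟶ X) (W : X.Opens) (hx : imagePoint p ∈ W)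
    (hW : ⊤ ≤ p ⁻¹ᵁ W) (g : Γ(X, W)) :
    Scheme.stalkClosedPointTo p (X.presheaf.germ W _ hx g) =
      (Scheme.ΓSpecIso (.of K)).hom (p.appLE W ⊤ hW g) :=
  ConcreteCategory.congr_hom (Scheme.germ_stalkClosedPointTo (R := .of K) p W hx) g

/-- A `K`-point of an open subscheme `W`. -/
theorem exists_comp_ι_eq (p : Spec (.of K) ⟶ X) (W : X.Opens) (hx : imagePoint p ∈ W) :
    ∃ q : Spec (.of K) ⟶ W, q ≫ W.ι = p := by
  refine ⟨IsOpenImmersion.lift W.ι p ?_, IsOpenImmersion.lift_fac _ _ _⟩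
  rw [Scheme.Opens.range_ι]
  rintro _ ⟨y, rfl⟩
  exact (Scheme.preimage_eq_top_of_closedPoint_mem (R := .of K) p hx).ge trivial

/-- The pullback to `Spec K` of an invertible function near a `K`-point is its value there. -/
theorem pullUnit_etalePullbackFst_openEtale (p : Spec (.of K) ⟶ X) (W : X.Opens)
    (hx : imagePoint p ∈ W) (a : Γ((openEtale W).left, ⊤)ˣ) (k : Kˣ)
    (hk : Scheme.stalkClosedPointTo p (X.presheaf.germ W _ hx (W.topIso.hom a.1)) = (k : K)) :
    pullUnit (etalePullbackFst p (openEtale W)) a = constUnit _ k := by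
  obtain ⟨q, hq⟩ := exists_comp_ι_eq p W hx
  have h1 : etalePullbackFst p (openEtale W) = ((etalePullback p).obj (openEtale W)).hom ≫ q := by
    refine (cancel_mono W.ι).1 ?_
    rw [Category.assoc, hq]
    exact etalePullbackFst_hom p (openEtale W)
  rw [h1]
  refine (pullUnit_comp _ _ _).trans (congrArg (pullUnit _) (Units.ext ?_))
  change q.appTop a.1 = (Scheme.ΓSpecIso (.of K)).inv (k : K)
  have hW : ⊤ ≤ p ⁻¹ᵁ W := (Scheme.preimage_eq_top_of_closedPoint_mem (R := .of K) p hx).ge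
  rw [← hk, stalkClosedPointTo_germ p W hx hW, ← CommRingCat.comp_apply (Scheme.ΓSpecIso _).hom,
    Iso.hom_inv_id, CommRingCat.id_apply]
  have h2 : W.topIso.hom ≫ p.appLE W ⊤ hW = q.appTop := by
    subst hq
    rw [← Scheme.Hom.appLE_comp_appLE q W.ι W ⊤ ⊤ (by simp) le_rfl]
    rw [ι_appLE_self, Iso.hom_inv_id_assoc]
    exact q.appLE_eq_app
  rw [← h2]
  rfl

/-- The base change to `Spec K` of a neighbourhood of a `K`-point is `Spec K`, so that its
invertible functions are the nonzero constants. -/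
theorem bijective_constUnit_openEtale (p : Spec (.of K) ⟶ X) (W : X.Opens)
    (hx : imagePoint p ∈ W) :
    Function.Bijective (constUnit ((etalePullback p).obj (openEtale W))) := by
  obtain ⟨q, hq⟩ := exists_comp_ι_eq p W hx
  -- the base change of `W` is an open subscheme of `Spec K` with a section
  have : IsSplitEpi (pullback.snd W.ι p) :=
    ⟨⟨⟨pullback.lift q (𝟙 _) (by rw [hq, Category.id_comp]), pullback.lift_snd _ _ _⟩⟩⟩
  have : IsIso (pullback.snd W.ι p) := isIso_of_mono_of_isSplitEpi _
  have : IsIso ((etalePullback p).obj (openEtale W)).hom := this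
  rw [constUnit]
  refine (bijective_pullUnit _).comp
    ((Units.mapEquiv (Scheme.ΓSpecIso (.of K)).symm.commRingCatIsoToRingEquiv.toMulEquiv).bijective)

theorem evalResidue_residue (p : Spec (.of K) ⟶ X) (a : X.presheaf.stalk (imagePoint p)) :
    evalResidue p (IsLocalRing.residue _ a) = Scheme.stalkClosedPointTo p a :=
  rfl

/-- The residue field of a `K`-point is `K`. -/
theorem evalResidue_bijective {p : Spec (.of K) ⟶ X} {π : X ⟶ Spec (.of K)} (hp : p ≫ π = 𝟙 _) :
    Function.Bijective (evalResidue p) := by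
  refine ⟨(evalResidue p).injective, fun k => ⟨IsLocalRing.residue _
    (X.presheaf.germ ⊤ _ trivial (π.appTop ((Scheme.ΓSpecIso (.of K)).inv k))), ?_⟩⟩
  rw [evalResidue_residue, stalkClosedPointTo_germ p ⊤ trivial le_rfl]
  have h : π.appTop ≫ p.appLE ⊤ ⊤ le_rfl = 𝟙 _ := by
    rw [← Scheme.Hom.id_appTop, ← hp, Scheme.Hom.comp_appTop]
    exact congrArg (π.appTop ≫ ·) p.appLE_eq_app
  rw [← CommRingCat.comp_apply π.appTop, h, CommRingCat.id_apply, ← CommRingCat.comp_apply,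
    Iso.inv_hom_id, CommRingCat.id_apply]

end Evaluation

/-! ### Sections of divisorial log structures -/

section Divisorial

variable {X : Scheme.{u}} {D : TopologicalSpace.Closeds X}

theorem divisorialLog_fn_injective (U : X.Etale) :
    Function.Injective ((divisorialLog X D).fn U) :=
  Subtype.val_injective

theorem mem_basicOpen_fn (U : X.Etale) (m : (divisorialLog X D).monoid.obj (op U)) (q : U.left)
    (hq : U.hom q ∉ D) : q ∈ U.left.basicOpen ((divisorialLog X D).fn U m) :=
  (isUnit_restrict_iff _ _).1 m.2 hq

/-- A function on an open subset which is invertible outside of `D` is a section of `ℳ`. -/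
theorem exists_openFn_eq {V : X.Opens} (s : Γ(X, V)) (h : ∀ y ∈ V, y ∉ D → y ∈ X.basicOpen s) :
    ∃ m : (divisorialLog X D).monoid.obj (op (openEtale V)), openFn _ V m = s := by
  refine ⟨⟨V.topIso.inv s, ?_⟩, ?_⟩
  · refine (isUnit_restrict_iff (V.ι ⁻¹ᵁ D.compl) _).2 fun y hy => ?_
    have h1 : V.ι y ∈ X.basicOpen s := h _ y.2 hy
    rw [← Scheme.Opens.ι_image_basicOpen_topIso_inv] at h1
    obtain ⟨y', hy', h2⟩ := h1
    rwa [← V.ι.injective h2]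
  · exact CommRingCat.inv_hom_apply V.topIso.symm s

theorem openFn_injective (V : X.Opens) :
    Function.Injective (openFn (divisorialLog X D) V) :=
  (ConcreteCategory.bijective_of_isIso V.topIso.hom).1.comp (divisorialLog_fn_injective _)

theorem openFn_mul (M : LogStructure X) (V : X.Opens) (m m' : M.monoid.obj (op (openEtale V))) :
    openFn M V (m * m') = openFn M V m * openFn M V m' := by
  rw [openFn, map_mul]
  exact map_mul V.topIso.hom.hom _ _

/-- The inclusion of open subsets as a morphism in the étale site. -/
def openEtaleHom {V W : X.Opens} (h : W ≤ V) : openEtale W ⟶ openEtale V :=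
  MorphismProperty.Over.homMk (X.homOfLE h) (X.homOfLE_ι h)

theorem openFn_map (M : LogStructure X) {V W : X.Opens} (h : W ≤ V)
    (m : M.monoid.obj (op (openEtale V))) :
    openFn M W (M.monoid.map (openEtaleHom h).op m) =
      X.presheaf.map (homOfLE h).op (openFn M V m) := by
  rw [openFn, openFn, fn_naturality]
  have h1 : (X.homOfLE h).appTop ≫ W.topIso.hom = V.topIso.hom ≫ X.presheaf.map (homOfLE h).op := by
    rw [Scheme.homOfLE_appTop, Scheme.Opens.topIso_hom, Scheme.Opens.topIso_hom]
    exact (X.presheaf.map_comp _ _).symm.trans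
      ((congrArg X.presheaf.map (Subsingleton.elim _ _)).trans (X.presheaf.map_comp _ _))
  exact ConcreteCategory.congr_hom h1 _

end Divisorial

section Values

variable {K : Type u} [Field K] {X : Scheme.{u}} {D : X.IdealSheafData} {p : Spec (.of K) ⟶ X}

theorem germ_restrict {x : X} {U W : X.Opens} (h : W ≤ U) (hx : x ∈ W) (s : Γ(X, U)) :
    X.presheaf.germ W x hx (X.presheaf.map (homOfLE h).op s) = X.presheaf.germ U x (h hx) s :=
  X.presheaf.germ_res_apply _ _ _ _

/-- If a virtual morphism maps `e` to the constant `c`, and `m` is `e` times a unit `b` of the local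
ring at the underlying `K`-point, then it maps `m` to `b(x) · c`. -/
theorem pullUnits_eq_of_germ_eq {α : (divisorialLog X D.support).gp.obj ⟶
      (etalePullback p).op ⋙ (trivialLog (Spec (.of K))).gp.obj} (hα)
    {V U : X.Opens} (hV : imagePoint p ∈ V) (hU : imagePoint p ∈ U)
    (e : (divisorialLog X D.support).monoid.obj (op (openEtale V)))
    (m : (divisorialLog X D.support).monoid.obj (op (openEtale U)))
    {b : X.presheaf.stalk (imagePoint p)} (hb : IsUnit b)
    (h : X.presheaf.germ U _ hU (openFn _ U m) = b * X.presheaf.germ V _ hV (openFn _ V e))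
    {c k : Kˣ} (hc : (⟨p, α, hα⟩ : VirtualHom _ _).pullUnits (openEtale V) e = constUnit _ c)
    (hk : (k : K) = Scheme.stalkClosedPointTo p b * c) :
    (⟨p, α, hα⟩ : VirtualHom _ _).pullUnits (openEtale U) m = constUnit _ k := by
  obtain ⟨W₀, hW₀, a₀, rfl⟩ := exists_germ_eq b
  -- on a neighbourhood `W` of the point, `m` is the product of `e` with an invertible function `a`
  -- which has germ `b`
  let W₁ : X.Opens := X.basicOpen a₀ ⊓ (U ⊓ V)
  have hW₁ : imagePoint p ∈ W₁ := ⟨(X.mem_basicOpen a₀ _ hW₀).2 hb, hU, hV⟩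
  have h1 : X.presheaf.germ W₁ _ hW₁ (X.presheaf.map (homOfLE (inf_le_right.trans inf_le_left)).op
        (openFn _ U m)) = X.presheaf.germ W₁ _ hW₁
      (X.presheaf.map (homOfLE (inf_le_left.trans (X.basicOpen_le _))).op a₀ *
        X.presheaf.map (homOfLE (inf_le_right.trans inf_le_right)).op (openFn _ V e)) := by
    rw [map_mul, germ_restrict, germ_restrict, germ_restrict]
    exact h
  obtain ⟨(W : X.Opens), hW, i, i', h2⟩ := X.presheaf.germ_eq _ hW₁ hW₁ _ _ h1
  let φ : VirtualHom (trivialLog (Spec (.of K))) (divisorialLog X D.support) := ⟨p, α, hα⟩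
  have hle : W ≤ W₁ := i.le
  have ha : IsUnit (X.presheaf.map (homOfLE ((hle.trans inf_le_left).trans
      (X.basicOpen_le a₀))).op a₀) := isUnit_map_of_le_basicOpen a₀ (hle.trans inf_le_left)
  let a : Γ((openEtale W).left, ⊤)ˣ := (ha.map W.topIso.inv.hom).unit
  have ha' : W.topIso.hom a.1 = X.presheaf.map (homOfLE ((hle.trans inf_le_left).trans
      (X.basicOpen_le a₀))).op a₀ := CommRingCat.inv_hom_apply W.topIso.symm _
  have hWU : W ≤ U := hle.trans (inf_le_right.trans inf_le_left)
  have hWV : W ≤ V := hle.trans (inf_le_right.trans inf_le_right)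
  have hm : (divisorialLog X D.support).monoid.map (openEtaleHom hWU).op m =
      (divisorialLog X D.support).ofUnit _ a *
        (divisorialLog X D.support).monoid.map (openEtaleHom hWV).op e := by
    refine openFn_injective W ?_
    have hoa : openFn (divisorialLog X D.support) W (LogStructure.ofUnit _ _ a) =
        W.topIso.hom a.1 := congrArg W.topIso.hom (LogStructure.fn_ofUnit _ _ a)
    rw [openFn_map, openFn_mul, openFn_map, hoa, ha']
    rw [map_mul] at h2
    simp only [← CommRingCat.comp_apply, ← Functor.map_comp] at h2
    exact h2
  let k₀ : Kˣ := (hb.map (Scheme.stalkClosedPointTo p).hom).unit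
  have hk₀ : pullUnit (etalePullbackFst p (openEtale W)) a = constUnit _ k₀ := by
    refine pullUnit_etalePullbackFst_openEtale p W hW a k₀ ?_
    rw [ha', germ_restrict]
    rfl
  refine unit_ext_of_cover p fun y => ⟨openEtale W, openEtaleHom hWU, ⟨_, hW⟩, ?_, ?_⟩
  · refine U.ι.injective ?_
    refine (congrArg (fun φ => φ.base (⟨_, hW⟩ : W)) (X.homOfLE_ι hWU)).trans ?_
    exact (etalePullbackFst_apply p (openEtale U) y).symm
  · refine (φ.pullUnits_naturality (openEtaleHom hWU) m).symm.trans ?_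
    rw [hm, map_mul, φ.pullUnits_ofUnit, φ.pullUnits_naturality, hc]
    refine (congrArg₂ _ hk₀ (constUnit_naturality _ c)).trans ?_
    refine Eq.trans ?_ (constUnit_naturality _ k).symm
    rw [← map_mul]
    exact congrArg _ (Units.ext hk.symm)

end Values

/-! ### Virtual morphisms in terms of local equations -/

section Charts

variable {K : Type u} [Field K] {X : Scheme.{u}} [IsRegularScheme X] {D : X.IdealSheafData}
  {p : Spec (.of K) ⟶ X} {j : ℕ} {z : Fin j → maxIdeal X (imagePoint p)} {V : X.Opens}
  {ζ : Fin j → Γ(X, V)}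

/-- The leading coefficient of the equation `ζ_i` is `c_i`. -/
theorem HasLeadingCoeff.of_equation {X U P : Scheme.{u}} {V : X.Opens} {ζ : Fin j → Γ(X, V)}
    {f : U ⟶ X} {r : P ⟶ U} {c : Fin j → Γ(P, ⊤)} (hV : ⊤ ≤ f ⁻¹ᵁ V) (i : Fin j) :
    HasLeadingCoeff ζ f r c (f.appLE V ⊤ hV (ζ i)) (c i) := by
  intro y
  have h1 {R : CommRingCat.{u}} (t : Fin j → R) :
      ∏ k, t k ^ (Pi.single i 1 : Fin j → ℕ) k = t i := by
    rw [Finset.prod_eq_single i (fun k _ hk => by rw [Pi.single_eq_of_ne hk, pow_zero])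
      (fun h => (h (Finset.mem_univ i)).elim), Pi.single_eq_same, pow_one]
  refine ⟨⊤, hV, ⊤, le_rfl, 1, Pi.single i 1, trivial, ⟨isUnit_one, ?_⟩, ?_⟩
  · rw [h1 fun k => f.appLE V ⊤ hV (ζ k), one_mul, ← CommRingCat.comp_apply, Scheme.Hom.appLE_map]
  · change _ = r.appLE ⊤ ⊤ le_rfl 1 * ∏ k, P.presheaf.map (homOfLE le_top).op (c k) ^
      (Pi.single i 1 : Fin j → ℕ) k
    rw [h1 fun k => P.presheaf.map (homOfLE le_top).op (c k), map_one, one_mul]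

/-- Given nonzero constants `c_i`, there is a virtual morphism which maps `ζ_i` to `c_i`: it maps a
function which is locally `a · ∏ ζ_i ^ n_i` to the restriction of `a` times `∏ c_i ^ n_i`. -/
theorem IsLocalEquations.exists_virtualHom (hz : IsLocalEquations D z) (hx : imagePoint p ∈ V)
    (hζ : ∀ i, X.presheaf.germ V _ hx (ζ i) = z i) (c : Fin j → Kˣ) :
    ∃ (α : (divisorialLog X D.support).gp.obj ⟶
        (etalePullback p).op ⋙ (trivialLog (Spec (.of K))).gp.obj) (hα : _),
      ∀ (i : Fin j) (e : (divisorialLog X D.support).monoid.obj (op (openEtale V))),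
        openFn _ V e = ζ i →
        (⟨p, α, hα⟩ : VirtualHom _ _).pullUnits (openEtale V) e = constUnit _ (c i) := by
  let M := divisorialLog X D.support
  let C (U : X.Etale) (i : Fin j) : Γ(((etalePullback p).obj U).left, ⊤) :=
    (constUnit ((etalePullback p).obj U) (c i)).1
  have hex (U : X.Etale) (m : M.monoid.obj (op U)) : ∃ s : Γ(((etalePullback p).obj U).left, ⊤)ˣ,
      HasLeadingCoeff ζ U.hom (etalePullbackFst p U) (C U) (M.fn U m) s.1 := by
    have := U.prop
    obtain ⟨s, hs⟩ := exists_hasLeadingCoeff hz hx hζ (etalePullbackFst_apply p U) (C U)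
      (mem_basicOpen_fn U m)
    exact ⟨(hs.isUnit fun i => (constUnit _ (c i)).isUnit).unit, hs⟩
  have huniq (U : X.Etale) (m : Γ(U.left, ⊤)) (s t : Γ(((etalePullback p).obj U).left, ⊤)ˣ)
      (hs : HasLeadingCoeff ζ U.hom (etalePullbackFst p U) (C U) m s.1)
      (ht : HasLeadingCoeff ζ U.hom (etalePullbackFst p U) (C U) m t.1) : s = t := by
    have := U.prop
    exact Units.ext (HasLeadingCoeff.unique hz hx hζ (etalePullbackFst_apply p U) (C U) hs ht)
  choose h hh using hex
  have hunit (U : X.Etale) (a : Γ(U.left, ⊤)ˣ) :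
      h U (M.ofUnit U a) = pullUnit (etalePullbackFst p U) a := by
    refine huniq U a.1 _ _ ?_ (.of_isUnit a.isUnit fun y => ?_)
    · have h1 := hh U (M.ofUnit U a)
      rwa [M.fn_ofUnit] at h1
    · rwa [etalePullbackFst_apply p U y]
  obtain ⟨α, hα, hval⟩ := exists_pull (N := M) (p := p)
    (fun U =>
      { toFun := h U
        map_one' := by
          have h1 := hunit U 1
          rwa [map_one, map_one] at h1
        map_mul' := fun m m' => by
          refine huniq U _ _ _ (hh U (m * m')) ?_
          rw [map_mul]
          exact (hh U m).mul (hh U m') })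
    (fun {U W} f m => by
      refine huniq U _ _ _ (hh U _) ?_
      rw [fn_naturality]
      exact (hh W m).comap f.left ((etalePullback p).map f).left
        (CategoryTheory.Over.w f.toCommaMorphism) (etalePullback_map_fst p f).symm
        fun i => congrArg Units.val (constUnit_naturality ((etalePullback p).map f) (c i)))
    hunit
  refine ⟨α, hα, fun i e he => (hval _ _).trans (huniq _ _ _ _ (hh _ e) ?_)⟩
  have hV : ⊤ ≤ V.ι ⁻¹ᵁ V := by simp
  have h1 : M.fn (openEtale V) e = V.ι.appLE V ⊤ hV (ζ i) := by
    rw [ι_appLE_self, ← he]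
    exact (CommRingCat.inv_hom_apply V.topIso _).symm
  rw [h1]
  exact HasLeadingCoeff.of_equation (f := V.ι) hV i

/-- Étale-locally near the points over `imagePoint p`, a section of the divisorial log structure is
the product of an invertible function and a monomial in the local equations. -/
theorem IsLocalEquations.exists_eq_ofUnit_mul_prod (hz : IsLocalEquations D z)
    (hx : imagePoint p ∈ V) (hζ : ∀ i, X.presheaf.germ V _ hx (ζ i) = z i)
    {e : Fin j → (divisorialLog X D.support).monoid.obj (op (openEtale V))}
    (he : ∀ i, openFn _ V (e i) = ζ i) {U : X.Etale}
    (m : (divisorialLog X D.support).monoid.obj (op U)) {y : U.left}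
    (hy : U.hom y = imagePoint p) :
    ∃ (W : X.Etale) (g : W ⟶ U) (w : W.left) (q : W ⟶ openEtale V) (a : Γ(W.left, ⊤)ˣ)
      (n : Fin j → ℕ), g.left w = y ∧ (divisorialLog X D.support).monoid.map g.op m =
        (divisorialLog X D.support).ofUnit W a *
          ∏ i, (divisorialLog X D.support).monoid.map q.op (e i) ^ n i := by
  have := U.prop
  obtain ⟨W, hW, hyW, a, n, ha, h⟩ := hz.exists_factorization hx hζ U.hom hy (mem_basicOpen_fn U m)
  have : Etale (W.ι ≫ U.hom) := inferInstance
  -- `W` is an étale `X`-scheme, and its structure morphism factors through `V`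
  let W' : X.Etale := Scheme.Etale.mk (W.ι ≫ U.hom)
  let g : W' ⟶ U := MorphismProperty.Over.homMk W.ι rfl
  have hr : Set.range (W.ι ≫ U.hom) ⊆ Set.range V.ι := by
    rw [Scheme.Opens.range_ι]
    rintro _ ⟨w, rfl⟩
    exact hW w.2
  let q₀ : W.toScheme ⟶ V.toScheme := IsOpenImmersion.lift V.ι (W.ι ≫ U.hom) hr
  have hq₀ : q₀ ≫ V.ι = W.ι ≫ U.hom := IsOpenImmersion.lift_fac _ _ _
  let q : W' ⟶ openEtale V := MorphismProperty.Over.homMk q₀ hq₀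
  let a' : Γ(W'.left, ⊤)ˣ := (ha.map W.topIso.inv.hom).unit
  refine ⟨W', g, ⟨y, hyW⟩, q, a', n, rfl, ?_⟩
  refine divisorialLog_fn_injective W' ?_
  have h1 : V.topIso.inv ≫ q₀.appTop = U.hom.appLE V W hW ≫ W.topIso.inv := by
    have h3 : (q₀ ≫ V.ι).appLE V ⊤ (fun w _ => (q₀ w).2) =
      (W.ι ≫ U.hom).appLE V ⊤ (fun w _ => hW w.2) := by simp only [hq₀]
    rw [← Scheme.Hom.appLE_comp_appLE q₀ V.ι V ⊤ ⊤ (by simp) le_rfl,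
      ← Scheme.Hom.appLE_comp_appLE W.ι U.hom V W ⊤ hW (by simp), ι_appLE_self, ι_appLE_self] at h3
    exact (congrArg (V.topIso.inv ≫ ·) q₀.appLE_eq_app.symm).trans h3
  have h2 (i) : (divisorialLog X D.support).fn W'
      ((divisorialLog X D.support).monoid.map q.op (e i)) =
        W.topIso.inv (U.hom.appLE V W hW (ζ i)) := by
    rw [fn_naturality, ← he i, ← CommRingCat.comp_apply, ← h1]
    exact congrArg q₀.appTop (CommRingCat.inv_hom_apply V.topIso _).symm
  have h3 : W.ι.appTop ((divisorialLog X D.support).fn U m) =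
      W.topIso.inv (U.left.presheaf.map (homOfLE le_top).op
        ((divisorialLog X D.support).fn U m)) := by
    rw [← ι_appLE_self W (by simp), ← CommRingCat.comp_apply, Scheme.Hom.map_appLE]
    exact congrArg (fun τ => τ.hom ((divisorialLog X D.support).fn U m))
      W.ι.appLE_eq_app.symm
  rw [fn_naturality, map_mul, LogStructure.fn_ofUnit _ W' a', map_prod]
  simp only [map_pow, h2]
  refine h3.trans ((congrArg W.topIso.inv h).trans ?_)
  rw [map_mul, map_prod]
  simp only [map_pow]
  rfl

/-- A virtual morphism is determined by its underlying morphism of schemes and its values on local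
equations. -/
theorem IsLocalEquations.virtualHom_ext (hz : IsLocalEquations D z)
    (hx : imagePoint p ∈ V) (hζ : ∀ i, X.presheaf.germ V _ hx (ζ i) = z i)
    {e : Fin j → (divisorialLog X D.support).monoid.obj (op (openEtale V))}
    (he : ∀ i, openFn _ V (e i) = ζ i)
    {α β : (divisorialLog X D.support).gp.obj ⟶
      (etalePullback p).op ⋙ (trivialLog (Spec (.of K))).gp.obj} (hα hβ)
    (h : ∀ i, (⟨p, α, hα⟩ : VirtualHom _ _).pullUnits (openEtale V) (e i) =
      (⟨p, β, hβ⟩ : VirtualHom _ _).pullUnits (openEtale V) (e i)) :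
    (⟨p, α, hα⟩ : VirtualHom _ (divisorialLog X D.support)) = ⟨p, β, hβ⟩ := by
  -- where `m = a · ∏ e_i ^ n_i`, its pullback is the pullback of `a` times a monomial in those of
  -- the `e_i`
  have key (φ : VirtualHom (trivialLog (Spec (.of K))) (divisorialLog X D.support)) {U W : X.Etale}
      (g : W ⟶ U) (q : W ⟶ openEtale V) (a : Γ(W.left, ⊤)ˣ) (n : Fin j → ℕ)
      (m : (divisorialLog X D.support).monoid.obj (op U))
      (hm : (divisorialLog X D.support).monoid.map g.op m =
        (divisorialLog X D.support).ofUnit W a *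
          ∏ i, (divisorialLog X D.support).monoid.map q.op (e i) ^ n i) :
      pullUnit ((etalePullback φ.base).map g).left (φ.pullUnits U m) =
        pullUnit (etalePullbackFst φ.base W) a *
          ∏ i, pullUnit ((etalePullback φ.base).map q).left (φ.pullUnits _ (e i)) ^ n i := by
    rw [← φ.pullUnits_naturality, hm, map_mul, φ.pullUnits_ofUnit, map_prod]
    congr 1
    exact Finset.prod_congr rfl fun i _ => by rw [map_pow, φ.pullUnits_naturality]
  refine VirtualHom.ext_of_pullSection hα hβ fun U m => ?_
  have h1 : (⟨p, α, hα⟩ : VirtualHom _ _).pullUnits U m =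
      (⟨p, β, hβ⟩ : VirtualHom _ _).pullUnits U m := by
    refine unit_ext_of_cover p fun y => ?_
    obtain ⟨W, g, w, q, a, n, hw, hm⟩ := hz.exists_eq_ofUnit_mul_prod hx hζ he m
      (etalePullbackFst_apply p U y)
    refine ⟨W, g, w, hw, ?_⟩
    have h2 := key ⟨p, α, hα⟩ g q a n m hm
    have h3 := key ⟨p, β, hβ⟩ g q a n m hm
    refine h2.trans (Eq.trans ?_ h3.symm)
    congr 1
    exact Finset.prod_congr rfl fun i _ => by rw [h i]
  have h2 := (VirtualHom.unitToGp_pullUnits ⟨p, α, hα⟩ U m).symm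
  rw [h1] at h2
  exact h2.trans (VirtualHom.unitToGp_pullUnits ⟨p, β, hβ⟩ U m)

end Charts

/-! ### Virtual points and tangential basepoints -/

section Correspondence

variable {K : Type u} [Field K] {X : Scheme.{u}} {π : X ⟶ Spec (.of K)} [IsRegularScheme X]
  {D : X.IdealSheafData}

/-- It is enough to check the correspondence between a virtual point and a tangential basepoint on
one local equation for each component. -/
theorem IsLocalEquations.corresponds_iff {p : Spec (.of K) ⟶ X} {j : ℕ}
    {z : Fin j → maxIdeal X (imagePoint p)} (hz : IsLocalEquations D z) {V : X.Opens}
    (hx : imagePoint p ∈ V)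
    {e : Fin j → (divisorialLog X D.support).monoid.obj (op (openEtale V))}
    (he : ∀ i, X.presheaf.germ V _ hx (openFn _ V (e i)) = z i)
    {α : (divisorialLog X D.support).gp.obj ⟶
      (etalePullback p).op ⋙ (trivialLog (Spec (.of K))).gp.obj} (hα) (hp hp' : p ≫ π = 𝟙 _)
    (v : TangentSpaceAt X (imagePoint p)) (hv) :
    Corresponds (⟨⟨p, α, hα⟩, hp⟩ : VirtualPoint π (divisorialLog X D.support))
        ⟨p, hp', Submodule.Quotient.mk v, hv⟩ ↔
      ∀ i, ∃ c : Kˣ, (c : K) = evalResidue p (v (differential (z i))) ∧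
        (⟨p, α, hα⟩ : VirtualHom _ _).pullUnits (openEtale V) (e i) = constUnit _ c := by
  constructor
  · rintro ⟨-, h⟩ i
    obtain ⟨c, hc, hφ⟩ := h V hx (e i) (z i) (hz.branch i) (he i) (hz.branch_mem_branches i)
      (hz.vanishingIdealAt_branch i) v rfl
    exact ⟨c, hc, (VirtualHom.pullUnits_eq_iff _ _ _ _).2 hφ⟩
  · refine fun h => ⟨rfl, fun U hU m z' Z hm hZ hZz w hw => ?_⟩
    have : IsDomain (X.presheaf.stalk (imagePoint p)) := isDomain_of_isRegularLocalRing _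
    obtain ⟨i, rfl⟩ := hz.branches_eq.le hZ
    have h1 := (hz.vanishingIdealAt_branch i).symm.trans hZz
    obtain ⟨b, hb⟩ := Ideal.span_singleton_eq_span_singleton.1 h1
    obtain ⟨c, hc, hφ⟩ := h i
    have h2 : (z' : X.presheaf.stalk (imagePoint p)) = b * z i := by
      rw [← hb, mul_comm]
    have h3 := congrArg (evalResidue p) (apply_differential_eq_of_eq_mul w h2)
    rw [map_mul, (hz.mk_eq_mk_iff w v).1 hw i, ← hc, evalResidue_residue] at h3
    let k₀ : Kˣ := (b.isUnit.map (Scheme.stalkClosedPointTo p).hom).unit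
    refine ⟨k₀ * c, h3.symm, (VirtualHom.pullUnits_eq_iff _ _ _ _).1 ?_⟩
    refine pullUnits_eq_of_germ_eq hα hx hU (e i) m b.isUnit ?_ hφ rfl
    rw [hm, he, h2]

/-- Sections of the divisorial log structure which are local equations of the components through a
`K`-point. -/
theorem IsStrictNormalCrossing.exists_localEquations (hD : IsStrictNormalCrossing D) (x : X) :
    ∃ (j : ℕ) (z : Fin j → maxIdeal X x) (V : X.Opens) (hx : x ∈ V)
      (e : Fin j → (divisorialLog X D.support).monoid.obj (op (openEtale V))),
      IsLocalEquations D z ∧ ∀ i, X.presheaf.germ V _ hx (openFn _ V (e i)) = z i := by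
  obtain ⟨j, z, h1, h2⟩ := hD x
  have hz : IsLocalEquations D z := ⟨h1, h2⟩
  obtain ⟨V, hx, ζ, hζ, hζD⟩ := hz.exists_sections
  choose e he using fun i => exists_openFn_eq (D := D.support) (ζ i) (hζD i)
  exact ⟨j, z, V, hx, e, hz, fun i => by rw [he, hζ]⟩

/-- The normal vector has the coordinates `φ^*(z_i)`, which are constants since the `z_i` are
defined on a Zariski neighbourhood of the point. -/
theorem existsUnique_tangentialBasepoint (hD : IsStrictNormalCrossing D)
    (φ : VirtualPoint π (divisorialLog X D.support)) :
    ∃! t : TangentialBasepoint π D.support, Corresponds φ t := by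
  obtain ⟨⟨p, α, hα⟩, hp⟩ := φ
  obtain ⟨j, z, V, hx, e, hz, he⟩ := hD.exists_localEquations (imagePoint p)
  choose c hc using fun i => (bijective_constUnit_openEtale p V hx).2
    ((⟨p, α, hα⟩ : VirtualHom _ _).pullUnits (openEtale V) (e i))
  choose a ha using fun i => (evalResidue_bijective hp).2 (c i : K)
  obtain ⟨v, hv⟩ := hz.exists_tangent a
  have hva (i) : evalResidue p (v (differential (z i))) = c i := by
    rw [hv, ha]
  have hin : IsInwardPointing D.support (Submodule.Quotient.mk v) :=
    (hz.isInwardPointing_mk_iff v).2 fun i h0 => by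
      have h1 := hva i
      rw [h0, map_zero] at h1
      exact (c i).ne_zero h1.symm
  refine ⟨⟨p, hp, Submodule.Quotient.mk v, hin⟩, ?_, ?_⟩
  · exact (hz.corresponds_iff hx he hα hp hp v hin).2 fun i => ⟨c i, (hva i).symm, (hc i).symm⟩
  · rintro ⟨p', hp', w, hw⟩ h
    obtain rfl : p = p' := h.1
    obtain ⟨w, rfl⟩ := Submodule.Quotient.mk_surjective _ w
    have h1 := (hz.corresponds_iff hx he hα hp hp' w hw).1 h
    have h2 : (Submodule.Quotient.mk w : NormalSpace D.support (imagePoint p)) =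
        Submodule.Quotient.mk v := (hz.mk_eq_mk_iff w v).2 fun i => by
      obtain ⟨c', hc', h3⟩ := h1 i
      obtain rfl : c' = c i :=
        (bijective_constUnit_openEtale p V hx).1 (h3.symm.trans (hc i).symm)
      exact (evalResidue p).injective (hc'.symm.trans (hva i).symm)
    congr 1

/-- The virtual point maps the equations `z_i` to the coordinates `⟨dz_i, v⟩`, which are nonzero
because `v` is inward pointing. -/
theorem existsUnique_virtualPoint (hD : IsStrictNormalCrossing D)
    (t : TangentialBasepoint π D.support) :
    ∃! φ : VirtualPoint π (divisorialLog X D.support), Corresponds φ t := by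
  obtain ⟨p, hp, v, hin⟩ := t
  obtain ⟨v, rfl⟩ := Submodule.Quotient.mk_surjective _ v
  obtain ⟨j, z, V, hx, e, hz, he⟩ := hD.exists_localEquations (imagePoint p)
  have hne (i) : evalResidue p (v (differential (z i))) ≠ 0 :=
    (map_ne_zero _).2 ((hz.isInwardPointing_mk_iff v).1 hin i)
  obtain ⟨α, hα, h⟩ := hz.exists_virtualHom hx he fun i => Units.mk0 _ (hne i)
  refine ⟨⟨⟨p, α, hα⟩, hp⟩, ?_, ?_⟩
  · exact (hz.corresponds_iff hx he hα hp hp v hin).2 fun i => ⟨_, rfl, h i _ rfl⟩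
  · rintro ⟨⟨p', β, hβ⟩, hp'⟩ h'
    obtain rfl : p' = p := h'.1
    have h1 := (hz.corresponds_iff hx he hβ hp' hp v hin).1 h'
    have h2 := hz.virtualHom_ext hx he (fun _ => rfl) hβ hα fun i => by
      obtain ⟨c, hc, h3⟩ := h1 i
      rw [h i _ rfl, h3]
      exact congrArg _ (Units.ext hc)
    congr 1

end Correspondence

end

end LogGeometry

theorem mainTheorem1 (K : Type u) [Field K] (X : Scheme.{u}) (π : X ⟶ Spec (.of K))
    [LogGeometry.IsRegularScheme X] (D : X.IdealSheafData)
    (hD : LogGeometry.IsStrictNormalCrossing D) :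
    ∃! Φ : LogGeometry.VirtualPoint π (LogGeometry.divisorialLog X D.support) ≃
        LogGeometry.TangentialBasepoint π D.support,
      ∀ φ : LogGeometry.VirtualPoint π (LogGeometry.divisorialLog X D.support),
        LogGeometry.Corresponds φ (Φ φ) := by
  choose f hf hf' using LogGeometry.existsUnique_tangentialBasepoint (π := π) hD
  choose g hg hg' using LogGeometry.existsUnique_virtualPoint (π := π) hD
  refine ⟨⟨f, g, fun φ => (hg' _ φ (hf φ)).symm, fun t => (hf' _ t (hg t)).symm⟩, hf,
    fun Φ hΦ => Equiv.ext fun φ => hf' φ _ (hΦ φ)⟩
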